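/- There is a universal constant $C>0$ such that the following holds. Let $t\ge 0$, let $A_0,\dots,A_t\in\{0,1\}^{n\times n}$ be random symmetric matrices with zero diagonal, $a^{(k)}_{ii}=0$ and $a^{(k)}_{ji}=a^{(k)}_{ij}$, whose entries $a^{(k)}_{ij}\sim\mathrm{Ber}(p^{(k)}_{ij})$, $0\le k\le t$, $1\le i<j\le n$, are independent, and assume $p^{(k)}_{ij}\le\alpha_n$ for all $k$ and all $i\ne j$. Let $\beta_0,\dots,\beta_t\ge 0$ be weights such that, for some constants $\beta_{\max},C_\beta,C'_\beta>0$ and some $\epsilon_n\ge 0$, \[ \sum_{k=0}^t\beta_k=1,\qquad \beta_k\le\beta_{\max}\ (0\le k\le t),\qquad \sum_{k=0}^t\beta_k^2\le C_\beta\beta_{\max},\qquad \sum_{k=0}^t\beta_k\min(1,\sqrt{k\epsilon_n})\le C'_\beta\sqrt{\frac{\epsilon_n}{\beta_{\max}}}. \] Let $A=\sum_{k=0}^t\beta_kA_{t-k}$ and $P=\mathbb{E}(A)$, and let $\|\cdot\|$ be the spectral norm. Then for all $c>0$, \[ \mathbb{P}\left(\|A-P\|\ge C(1+c)\sqrt{n\alpha_n\beta_{\max}}\right)\le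 e^{-\left(\frac{c^2/2}{2C_\beta+\frac23c}-\log(14)\right)n}+e^{-\frac{c^2/2}{C_\beta+2c/3}\cdot\frac{n\alpha_n}{\beta_{\max}}+\log n}+n^{-\frac c4+6}. \] -/

import Mathlib

open MeasureTheory ProbabilityTheory

noncomputable section

/-- The spectral norm of a real square matrix: its operator norm for the Euclidean norm. -/
def matrixSpectralNorm {n : ℕ} (M : Matrix (Fin n) (Fin n) ℝ) : ℝ :=
  ‖Matrix.toEuclideanCLM (n := Fin n) (𝕜 := ℝ) M‖

/-- The random matrices `A 0, …, A t` are symmetric Bernoulli matrices: the entries are symmetric,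
vanish on the diagonal, the entry `(i, j)` of `A k` with `i ≠ j` is `1` with probability `p k i j`
and `0` otherwise, and all the entries above the diagonal, of all the matrices, are (jointly)
independent. -/
structure IsSymmBernoulliFamily {Ω : Type*} [MeasurableSpace Ω] (μ : Measure Ω) {t n : ℕ}
    (A : Fin (t + 1) → Ω → Matrix (Fin n) (Fin n) ℝ)
    (p : Fin (t + 1) → Fin n → Fin n → unitInterval) : Prop where
  symm : ∀ k ω i j, A k ω j i = A k ω i j
  diag : ∀ k ω i, A k ω i i = 0
  law : ∀ k i j, i ≠ j → HasLaw (fun ω => A k ω i j) (bernoulliMeasure (1 : ℝ) 0 (p k i j)) μ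
  indep : iIndepFun
    (fun (e : Fin (t + 1) × {q : Fin n × Fin n // q.1 < q.2}) ω =>
      A e.1 ω e.2.1.1 e.2.1.2) μ

/-- The conditions on non-negative weights `β 0, …, β t`, with constants
`βmax, Cβ, Cβ' > 0` and regularity parameter `ε ≥ 0`. -/
structure SmoothingWeights {t : ℕ} (β : Fin (t + 1) → ℝ) (βmax Cβ Cβ' ε : ℝ) : Prop where
  βmax_pos : 0 < βmax
  Cβ_pos : 0 < Cβ
  Cβ'_pos : 0 < Cβ'
  ε_nonneg : 0 ≤ ε
  nonneg : ∀ k, 0 ≤ β k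
  sum_eq_one : ∑ k, β k = 1
  le_max : ∀ k, β k ≤ βmax
  sum_sq_le : ∑ k, β k ^ 2 ≤ Cβ * βmax
  sum_min_le : ∑ k, β k * min 1 (Real.sqrt ((k : ℕ) * ε)) ≤ Cβ' * Real.sqrt (ε / βmax)

/-- The smoothed random matrix `∑ k, β k • A (t - k)`; for `k : Fin (t + 1)`, `k.rev` is `t - k`. -/
def smoothedMatrix {Ω : Type*} {t n : ℕ} (β : Fin (t + 1) → ℝ)
    (A : Fin (t + 1) → Ω → Matrix (Fin n) (Fin n) ℝ) (ω : Ω) : Matrix (Fin n) (Fin n) ℝ :=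
  ∑ k, β k • A k.rev ω

/-- The entrywise expectation of a random matrix. -/
def matrixExpectation {Ω : Type*} [MeasurableSpace Ω] (μ : Measure Ω) {n : ℕ}
    (M : Ω → Matrix (Fin n) (Fin n) ℝ) : Matrix (Fin n) (Fin n) ℝ :=
  Matrix.of fun i j => ∫ ω, M ω i j ∂μ

end

/-! The proof is the Kahn–Szemerédi argument with light and heavy pairs. Put `r = √(nα/βmax)`.
Divided by `βmax`, the smoothed matrix has entries that are sums of independent Bernoulli variables
with weights at most 1, of mean at most `r²/n`. It behaves like the adjacency matrix of a sparse
random graph of degree `r²`, so its deviation should have norm of order `r`; multiplying back, `βmax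
* r = √(nαβmax)`.

A net of `7 ^ n` unit vectors reduces the norm to quadratic forms at fixed `y`. Pairs with `n|y i||y
j| ≤ r` are light: their coefficients are small enough for Bernstein's inequality to beat the size
of the net, which gives the first error term.

On heavy pairs a union bound over the net is hopeless, and one uses instead two properties that do
not depend on `y`. All row sums are `O(r²)` (Bernstein, second error term). For all index sets `I`,
`J` with `|I| ≤ |J|`, the mass `e` of the block is either comparable to `m = |I||J|r²/n` or
satisfies `e log(e/m) ≲ |J| log(n/|J|)` (Chernoff and a union bound over small sets, third error
term). Given these, `heavy_sum_le` is deterministic: coordinates are grouped into dyadic levels,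
`dyadic_term_le` bounds each pair of levels, and `sum_dyadicBound_le` adds up geometric series. The
expectation on heavy pairs is bounded directly. -/

/-! ### Deterministic bound over heavy pairs -/

theorem sum_two_zpow_le (S : Finset ℤ) {X : ℝ} (hX : 0 < X) :
    ∑ s ∈ S, (if (2 : ℝ) ^ s ≤ X then (2 : ℝ) ^ s else 0) ≤ 2 * X := by
  have hM : (2 : ℝ) ^ Int.log 2 X ≤ X := by
    exact_mod_cast Int.zpow_log_le_self (b := 2) one_lt_two hX
  have hle : ∀ s : ℤ, (2 : ℝ) ^ s ≤ X ↔ s ≤ Int.log 2 X := fun s => by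
    exact_mod_cast Int.zpow_le_iff_le_log (b := 2) one_lt_two hX
  rw [← Finset.sum_filter]
  simp_rw [hle]
  set M := Int.log 2 X
  calc ∑ s ∈ S with s ≤ M, (2 : ℝ) ^ s
      = ∑ s ∈ S with s ≤ M, (2 : ℝ) ^ M * (1 / 2 : ℝ) ^ (M - s).toNat := by
        refine Finset.sum_congr rfl fun s hs => ?_
        have h : s ≤ M := (Finset.mem_filter.1 hs).2
        rw [← zpow_natCast, Int.toNat_of_nonneg (by lia), one_div, inv_zpow, ← zpow_neg,
          ← zpow_add₀ two_ne_zero]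
        congr 1
        ring
    _ = (2 : ℝ) ^ M * ∑ k ∈ (S.filter (· ≤ M)).image (fun s => (M - s).toNat),
          (1 / 2 : ℝ) ^ k := by
        rw [Finset.sum_image, Finset.mul_sum]
        intro s hs s' hs' h
        have h1 : s ≤ M := (Finset.mem_filter.1 hs).2
        have h2 : s' ≤ M := (Finset.mem_filter.1 hs').2
        simp only at h
        lia
    _ ≤ X * 2 := by
        gcongr
        exact (summable_geometric_two.sum_le_tsum _ fun _ _ => by positivity).trans_eq
          tsum_geometric_two
    _ = 2 * X := mul_comm _ _

theorem sum_two_zpow_inv_le (S : Finset ℤ) {X : ℝ} (hX : 0 < X) :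
    ∑ s ∈ S, (if X ≤ (2 : ℝ) ^ s then ((2 : ℝ) ^ s)⁻¹ else 0) ≤ 2 / X := by
  have h := sum_two_zpow_le (S.image Neg.neg) (inv_pos.2 hX)
  rw [Finset.sum_image fun _ _ _ _ => neg_inj.1] at h
  refine le_trans (le_of_eq ?_) (h.trans_eq (div_eq_mul_inv _ _).symm)
  refine Finset.sum_congr rfl fun s _ => ?_
  simp only [zpow_neg]
  congr 1
  rw [inv_le_inv₀ (by positivity) hX]

/-- The contribution of a pair of dyadic levels `u`, `v` with `a`, `b` indices to a heavy sum. -/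
theorem dyadic_term_le {n r K a b u v e : ℝ} (hn : 0 < n) (hr : 0 < r) (hK : Real.exp 1 ≤ K)
    (ha : 0 < a) (hb : 0 < b) (hbn : b ≤ n) (hu : 0 < u) (hv : 0 < v) (he : 0 ≤ e)
    (heavy : r < 4 * (u * v)) (deg : e ≤ a * (K * r ^ 2))
    (disc : e ≤ K * (a * b * r ^ 2 / n) ∨
      e * Real.log (e / (a * b * r ^ 2 / n)) ≤ K * (b * Real.log (n / b))) :
    u * v * e / n ≤ 4 * K * r * ((a * u ^ 2 / n) * (b * v ^ 2 / n))
      + (a * u ^ 2 / n) * (K * r ^ 2 * (if v ≤ u / r then v else 0) / u)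
      + (b * v ^ 2 / n) * (4 * K * (if u ≤ r * v then u else 0) / v)
      + (b * v ^ 2 / n) * (4 * K * (if u ≤ r then u else 0))
      + (a * u ^ 2 / n) * (r ^ 2 / u * (if r / (4 * u) ≤ v then v⁻¹ else 0)) := by
  have hK1 : 1 ≤ K := (Real.one_le_exp zero_le_one).trans hK
  have hK0 : 0 < K := by linarith
  have t1 : 0 ≤ 4 * K * r * ((a * u ^ 2 / n) * (b * v ^ 2 / n)) := by positivity
  have t2 : 0 ≤ (a * u ^ 2 / n) * (K * r ^ 2 * (if v ≤ u / r then v else 0) / u) := by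
    split_ifs <;> positivity
  have t3 : 0 ≤ (b * v ^ 2 / n) * (4 * K * (if u ≤ r * v then u else 0) / v) := by
    split_ifs <;> positivity
  have t4 : 0 ≤ (b * v ^ 2 / n) * (4 * K * (if u ≤ r then u else 0)) := by
    split_ifs <;> positivity
  have t5 : 0 ≤ (a * u ^ 2 / n) * (r ^ 2 / u * (if r / (4 * u) ≤ v then v⁻¹ else 0)) := by
    split_ifs <;> positivity
  set m := a * b * r ^ 2 / n with hm
  have hm0 : 0 < m := by positivity
  -- Mass comparable to `m`: heaviness replaces one factor `r` by `4uv`.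
  by_cases hA : e ≤ K * m
  · suffices u * v * e / n ≤ 4 * K * r * ((a * u ^ 2 / n) * (b * v ^ 2 / n)) by linarith
    calc u * v * e / n ≤ u * v * (K * m) / n := by gcongr
      _ = K * r * (a * b * u * v / n ^ 2) * r := by rw [hm]; field_simp
      _ ≤ K * r * (a * b * u * v / n ^ 2) * (4 * (u * v)) := by gcongr
      _ = _ := by field_simp
  -- Very unequal levels: the row-sum bound alone suffices.
  by_cases hB : v ≤ u / r
  · suffices u * v * e / n ≤ (a * u ^ 2 / n) * (K * r ^ 2 * (if v ≤ u / r then v else 0) / u) by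
      linarith
    rw [if_pos hB]
    calc u * v * e / n ≤ u * v * (a * (K * r ^ 2)) / n := by gcongr
      _ = _ := by field_simp
  have hB' : u ≤ r * v := by
    rw [not_le, div_lt_iff₀ hr] at hB
    linarith
  replace disc := disc.resolve_left hA
  push Not at hA
  obtain ⟨l, rfl⟩ : ∃ l, e = l * m := ⟨e / m, by field_simp⟩
  have hlK : K < l := lt_of_mul_lt_mul_right hA hm0.le
  have hl0 : 0 < l := hK0.trans hlK
  have hlog1 : 1 ≤ Real.log l := (Real.le_log_iff_exp_le hl0).2 (hK.trans hlK.le)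
  rw [mul_div_assoc, div_self hm0.ne', mul_one] at disc
  set L := Real.log (n / b) with hL
  have hL0 : 0 ≤ L := Real.log_nonneg ((one_le_div hb).2 hbn)
  have key : l * (a * r ^ 2 / n) * Real.log l ≤ K * L := by
    have : b * (l * (a * r ^ 2 / n) * Real.log l) ≤ b * (K * L) := by
      calc _ = l * m * Real.log l := by rw [hm]; ring
        _ ≤ _ := disc
        _ = _ := by ring
    exact le_of_mul_le_mul_left this hb
  have small : l * (a * r ^ 2 / n) ≤ K * L :=
    le_trans (le_mul_of_one_le_right (by positivity) hlog1) key
  -- When the logarithms are comparable, `log l` cancels from the discrepancy bound.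
  by_cases hCa : L ≤ 4 * Real.log l
  · suffices u * v * (l * m) / n ≤
      (b * v ^ 2 / n) * (4 * K * (if u ≤ r * v then u else 0) / v) by linarith
    rw [if_pos hB']
    have h4 : l * (a * r ^ 2 / n) ≤ 4 * K := by
      refine le_of_mul_le_mul_right (key.trans ?_) (zero_lt_one.trans_le hlog1)
      nlinarith
    calc u * v * (l * m) / n = u * v * b / n * (l * (a * r ^ 2 / n)) := by rw [hm]; ring
      _ ≤ u * v * b / n * (4 * K) := by gcongr
      _ = _ := by field_simp
  push Not at hCa
  have hl4 : l ^ 4 ≤ n / b := by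
    rw [← Real.log_le_log_iff (by positivity) (by positivity), Real.log_pow]
    exact_mod_cast hCa.le
  -- Now `l ^ 4 ≤ n / b`. Comparing with `v ^ 4` gives either `l ≤ v`, or `(l v)² ≤ n / b`, which
  -- makes the mass at level `v` absorb the factor `l`.
  by_cases hD : n / b ≤ v ^ 4
  · have hlv : l ≤ v := le_of_pow_le_pow_left₀ four_ne_zero hv.le (hl4.trans hD)
    by_cases hur : u ≤ r
    · suffices u * v * (l * m) / n ≤ (b * v ^ 2 / n) * (4 * K * (if u ≤ r then u else 0)) by
        linarith
      rw [if_pos hur]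
      have hLv : L ≤ 4 * v := by
        have h1 : L ≤ Real.log (v ^ 4) := Real.log_le_log (by positivity) hD
        rw [Real.log_pow] at h1
        have := Real.log_le_sub_one_of_pos hv
        push_cast at h1
        linarith
      calc u * v * (l * m) / n = u * v * b / n * (l * (a * r ^ 2 / n)) := by rw [hm]; ring
        _ ≤ u * v * b / n * (K * (4 * v)) := by
          exact mul_le_mul_of_nonneg_left (small.trans (by gcongr)) (by positivity)
        _ = _ := by ring
    · suffices u * v * (l * m) / n ≤ 4 * K * r * ((a * u ^ 2 / n) * (b * v ^ 2 / n)) by linarith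
      push Not at hur
      calc u * v * (l * m) / n ≤ u * v * (v * m) / n := by gcongr
        _ = a * b * u * v ^ 2 * r / n ^ 2 * r := by rw [hm]; field_simp
        _ ≤ a * b * u * v ^ 2 * r / n ^ 2 * u := by gcongr
        _ = 1 * r * ((a * u ^ 2 / n) * (b * v ^ 2 / n)) := by field_simp
        _ ≤ _ := by gcongr; linarith
  · suffices u * v * (l * m) / n ≤
      (a * u ^ 2 / n) * (r ^ 2 / u * (if r / (4 * u) ≤ v then v⁻¹ else 0)) by linarith
    rw [if_pos (by rw [div_le_iff₀ (by positivity)]; linarith)]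
    push Not at hD
    have hlb : l * (b * v ^ 2 / n) ≤ 1 := by
      have h1 : l ^ 4 * (v ^ 4) ≤ (n / b) * (n / b) :=
        mul_le_mul hl4 hD.le (by positivity) (by positivity)
      have h2 : (l * v) ^ 2 ≤ n / b := by
        refine le_of_pow_le_pow_left₀ two_ne_zero (by positivity) ?_
        calc _ = l ^ 4 * v ^ 4 := by ring
          _ ≤ _ := h1.trans_eq (by ring)
      have h3 : l * v ^ 2 ≤ n / b := by
        refine le_trans ?_ h2
        rw [mul_pow]
        gcongr
        exact le_self_pow₀ (hK1.trans hlK.le) two_ne_zero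
      calc l * (b * v ^ 2 / n) = (l * v ^ 2) / (n / b) := by field_simp
        _ ≤ 1 := (div_le_one (by positivity)).2 h3
    calc u * v * (l * m) / n = a * u * r ^ 2 / (n * v) * (l * (b * v ^ 2 / n)) := by
          rw [hm]; field_simp
      _ ≤ a * u * r ^ 2 / (n * v) * 1 := by gcongr
      _ = _ := by field_simp

/-- The bound on the contribution of the dyadic levels `2 ^ s`, `2 ^ t` with squared masses `w s`,
`w t` to a heavy sum. -/
noncomputable def dyadicBound (w : ℤ → ℝ) (r K : ℝ) (s t : ℤ) : ℝ :=
  4 * K * r * (w s * w t)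
      + w s * (K * r ^ 2 * (if (2 : ℝ) ^ t ≤ 2 ^ s / r then (2 : ℝ) ^ t else 0) / 2 ^ s)
      + w t * (4 * K * (if (2 : ℝ) ^ s ≤ r * 2 ^ t then (2 : ℝ) ^ s else 0) / 2 ^ t)
      + w t * (4 * K * (if (2 : ℝ) ^ s ≤ r then (2 : ℝ) ^ s else 0))
      + w s * (r ^ 2 / 2 ^ s * (if r / (4 * 2 ^ s) ≤ (2 : ℝ) ^ t then ((2 : ℝ) ^ t)⁻¹ else 0))

theorem dyadicBound_nonneg {w : ℤ → ℝ} (hw0 : ∀ s, 0 ≤ w s) {r K : ℝ} (hr : 0 < r) (hK : 0 ≤ K)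
    (s t : ℤ) : 0 ≤ dyadicBound w r K s t := by
  have h1 := hw0 s
  have h2 := hw0 t
  have p : ∀ (q : Prop) [Decidable q] (z : ℝ), 0 ≤ z → 0 ≤ (if q then z else 0) :=
    fun q _ z hz => by split_ifs <;> simp [hz]
  have p1 := p ((2 : ℝ) ^ t ≤ 2 ^ s / r) (2 ^ t) (by positivity)
  have p2 := p ((2 : ℝ) ^ s ≤ r * 2 ^ t) (2 ^ s) (by positivity)
  have p3 := p ((2 : ℝ) ^ s ≤ r) (2 ^ s) (by positivity)
  have p4 := p (r / (4 * 2 ^ s) ≤ (2 : ℝ) ^ t) ((2 ^ t)⁻¹) (by positivity)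
  unfold dyadicBound
  positivity

/-- In each term after the first, one level sums to a geometric series dominated by its extreme
term, and the other carries total mass at most 1. The constants add up to `4 + 2 + 8 + 8 + 8 = 30`.
-/
theorem sum_dyadicBound_le (S : Finset ℤ) {w : ℤ → ℝ} (hw0 : ∀ s, 0 ≤ w s)
    (hw : ∑ s ∈ S, w s ≤ 1) {r K : ℝ} (hr : 0 < r) (hK : 1 ≤ K) :
    ∑ s ∈ S, ∑ t ∈ S, dyadicBound w r K s t ≤ 30 * K * r := by
  have hK0 : 0 < K := by linarith
  have hmul : ∀ {a : ℝ}, 0 ≤ a → ∑ s ∈ S, w s * a ≤ a := fun {a} ha => by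
    rw [← Finset.sum_mul]
    exact mul_le_of_le_one_left ha hw
  simp only [dyadicBound, Finset.sum_add_distrib]
  have h1 : ∑ s ∈ S, ∑ t ∈ S, 4 * K * r * (w s * w t) ≤ 4 * K * r := by
    simp_rw [← Finset.mul_sum, ← Finset.sum_mul]
    exact mul_le_of_le_one_right (by positivity)
      (mul_le_one₀ hw (Finset.sum_nonneg fun _ _ => hw0 _) hw)
  have h2 : ∑ s ∈ S, ∑ t ∈ S, w s *
      (K * r ^ 2 * (if (2 : ℝ) ^ t ≤ 2 ^ s / r then (2 : ℝ) ^ t else 0) / 2 ^ s) ≤ 2 * K * r := by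
    refine le_trans (Finset.sum_le_sum fun s _ => ?_) (hmul (by positivity))
    rw [← Finset.mul_sum, ← Finset.sum_div, ← Finset.mul_sum]
    refine mul_le_mul_of_nonneg_left ?_ (hw0 s)
    calc _ ≤ K * r ^ 2 * (2 * (2 ^ s / r)) / 2 ^ s := by
          gcongr
          exact sum_two_zpow_le S (by positivity)
      _ = _ := by field_simp
  have h3 : ∑ s ∈ S, ∑ t ∈ S, w t *
      (4 * K * (if (2 : ℝ) ^ s ≤ r * 2 ^ t then (2 : ℝ) ^ s else 0) / 2 ^ t) ≤ 8 * K * r := by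
    rw [Finset.sum_comm]
    refine le_trans (Finset.sum_le_sum fun t _ => ?_) (hmul (by positivity))
    rw [← Finset.mul_sum, ← Finset.sum_div, ← Finset.mul_sum]
    refine mul_le_mul_of_nonneg_left ?_ (hw0 t)
    calc _ ≤ 4 * K * (2 * (r * 2 ^ t)) / 2 ^ t := by
          gcongr
          exact sum_two_zpow_le S (by positivity)
      _ = _ := by field_simp; ring
  have h4 : ∑ s ∈ S, ∑ t ∈ S, w t *
      (4 * K * (if (2 : ℝ) ^ s ≤ r then (2 : ℝ) ^ s else 0)) ≤ 8 * K * r := by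
    rw [Finset.sum_comm]
    refine le_trans (Finset.sum_le_sum fun t _ => ?_) (hmul (by positivity))
    rw [← Finset.mul_sum, ← Finset.mul_sum]
    refine mul_le_mul_of_nonneg_left ?_ (hw0 t)
    calc _ ≤ 4 * K * (2 * r) := by
          gcongr
          exact sum_two_zpow_le S hr
      _ = _ := by ring
  have h5 : ∑ s ∈ S, ∑ t ∈ S, w s * (r ^ 2 / 2 ^ s *
      (if r / (4 * 2 ^ s) ≤ (2 : ℝ) ^ t then ((2 : ℝ) ^ t)⁻¹ else 0)) ≤ 8 * K * r := by
    refine le_trans (Finset.sum_le_sum fun s _ => ?_) (hmul (by positivity))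
    rw [← Finset.mul_sum, ← Finset.mul_sum]
    refine mul_le_mul_of_nonneg_left ?_ (hw0 s)
    calc _ ≤ r ^ 2 / 2 ^ s * (2 / (r / (4 * 2 ^ s))) := by
          gcongr
          exact sum_two_zpow_inv_le S (by positivity)
      _ = 8 * 1 * r := by field_simp; ring
      _ ≤ _ := by gcongr
  linarith

set_option maxHeartbeats 1000000 in
/-- Heavy pairs: a non-negative symmetric matrix with bounded row sums and bounded discrepancy has a
small quadratic form over the pairs where the product of the coordinates is large. -/
theorem heavy_sum_le {n : ℕ} (hn : 0 < n) {r K : ℝ} (hr : 0 < r) (hK : Real.exp 1 ≤ K)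
    {B : Fin n → Fin n → ℝ} (hB0 : ∀ i j, 0 ≤ B i j) (hBs : ∀ i j, B j i = B i j)
    (deg : ∀ i, ∑ j, B i j ≤ K * r ^ 2)
    (disc : ∀ I J : Finset (Fin n), I.Nonempty → I.card ≤ J.card →
      ∑ i ∈ I, ∑ j ∈ J, B i j ≤ K * (I.card * J.card * r ^ 2 / n) ∨
      (∑ i ∈ I, ∑ j ∈ J, B i j) *
        Real.log ((∑ i ∈ I, ∑ j ∈ J, B i j) / (I.card * J.card * r ^ 2 / n)) ≤
          K * (J.card * Real.log (n / J.card)))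
    {x : Fin n → ℝ} (hx : ∑ i, x i ^ 2 ≤ 1) :
    ∑ i, ∑ j, (if r < n * (|x i| * |x j|) then B i j * (|x i| * |x j|) else 0) ≤ 240 * K * r := by
  have hK1 : 1 ≤ K := (Real.one_le_exp zero_le_one).trans hK
  have hK0 : 0 < K := by linarith
  have hn' : (0 : ℝ) < n := Nat.cast_pos.2 hn
  have hsq : 0 < √(n : ℝ) := Real.sqrt_pos.2 hn'
  have hsq2 : √(n : ℝ) * √(n : ℝ) = n := Real.mul_self_sqrt hn'.le
  -- The scaling by `√n` makes `n|x i||x j|` a product of two levels up to a factor 4. `Int.log`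
  -- takes the default value 0 at 0, so vanishing coordinates must be discarded, through `T`.
  let l : Fin n → ℤ := fun i => Int.log 2 (√(n : ℝ) * |x i|)
  let T : Finset (Fin n) := Finset.univ.filter fun i => x i ≠ 0
  let S : Finset ℤ := Finset.univ.image l
  let V : ℤ → Finset (Fin n) := fun s => T.filter fun i => l i = s
  have hlow : ∀ i ∈ T, (2 : ℝ) ^ l i ≤ √(n : ℝ) * |x i| := fun i hi => by
    have : 0 < |x i| := abs_pos.2 (Finset.mem_filter.1 hi).2
    exact_mod_cast Int.zpow_log_le_self (b := 2) one_lt_two (mul_pos hsq this)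
  have hupp : ∀ i, √(n : ℝ) * |x i| ≤ 2 * (2 : ℝ) ^ l i := fun i => by
    have := (Int.lt_zpow_succ_log_self (b := 2) one_lt_two (√(n : ℝ) * |x i|)).le
    rw [mul_comm 2, ← zpow_add_one₀ two_ne_zero]
    exact_mod_cast this
  have hprod : ∀ i j, n * (|x i| * |x j|) ≤ 4 * ((2 : ℝ) ^ l i * 2 ^ l j) := fun i j => by
    calc n * (|x i| * |x j|) = (√(n : ℝ) * |x i|) * (√(n : ℝ) * |x j|) := by
          linear_combination (-(|x i| * |x j|)) * hsq2
      _ ≤ (2 * (2 : ℝ) ^ l i) * (2 * (2 : ℝ) ^ l j) :=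
          mul_le_mul (hupp i) (hupp j) (by positivity) (by positivity)
      _ = _ := by ring
  have hfib : ∀ f : Fin n → ℝ, ∑ i ∈ T, f i = ∑ s ∈ S, ∑ i ∈ V s, f i := fun f =>
    (Finset.sum_fiberwise_of_maps_to (fun i _ => Finset.mem_image_of_mem _ (Finset.mem_univ i))
      f).symm
  let w : ℤ → ℝ := fun s => (V s).card * (2 ^ s) ^ 2 / n
  have hw0 : ∀ s, 0 ≤ w s := fun s => by positivity
  have hw : ∑ s ∈ S, w s ≤ 1 := by
    refine le_trans ?_ hx
    refine le_trans ?_ (Finset.sum_le_sum_of_subset_of_nonneg (Finset.subset_univ T)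
      fun i _ _ => sq_nonneg (x i))
    rw [hfib]
    refine Finset.sum_le_sum fun s _ => ?_
    calc w s = ∑ i ∈ V s, ((2 : ℝ) ^ s) ^ 2 / n := by
          simp only [w, Finset.sum_const, nsmul_eq_mul, mul_div_assoc]
      _ ≤ _ := by
          refine Finset.sum_le_sum fun i hi => ?_
          obtain ⟨hiT, rfl⟩ := Finset.mem_filter.1 hi
          rw [div_le_iff₀ hn', ← sq_abs (x i)]
          calc _ ≤ (√(n : ℝ) * |x i|) ^ 2 := by
                gcongr
                exact hlow i hiT
            _ = _ := by rw [mul_pow, Real.sq_sqrt hn'.le]; ring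
  let e : ℤ → ℤ → ℝ := fun s t => ∑ i ∈ V s, ∑ j ∈ V t, B i j
  have he0 : ∀ s t, 0 ≤ e s t := fun s t =>
    Finset.sum_nonneg fun i _ => Finset.sum_nonneg fun j _ => hB0 i j
  have hes : ∀ s t, e s t = e t s := fun s t => by
    simp only [e]
    rw [Finset.sum_comm]
    simp_rw [hBs]
  have hF := sum_dyadicBound_le S hw0 hw hr hK1
  have hF0 := dyadicBound_nonneg hw0 hr hK0.le
  -- The discrepancy hypothesis needs the smaller set first; the other order follows from the
  -- symmetry of `B`. Rounding (4), two orders (2) and the dyadic sum (30) give 240.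
  have half : ∀ s t, r < 4 * ((2 : ℝ) ^ s * 2 ^ t) → (V s).card ≤ (V t).card →
      (2 : ℝ) ^ s * 2 ^ t * e s t / n ≤ dyadicBound w r K s t := fun s t hst hcard => by
    rcases (V s).eq_empty_or_nonempty with h | h
    · simp only [e, h]
      simpa using hF0 s t
    have ha : (0 : ℝ) < (V s).card := Nat.cast_pos.2 h.card_pos
    refine dyadic_term_le hn' hr hK ha
      (ha.trans_le (Nat.cast_le.2 hcard)) ?_ (by positivity) (by positivity) (he0 s t) hst ?_
      (disc _ _ h hcard)
    · exact_mod_cast (Finset.card_le_univ (V t)).trans_eq (Fintype.card_fin n)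
    · calc e s t ≤ ∑ i ∈ V s, K * r ^ 2 := Finset.sum_le_sum fun i _ =>
            (Finset.sum_le_sum_of_subset_of_nonneg (Finset.subset_univ _)
              fun j _ _ => hB0 i j).trans (deg i)
        _ = _ := by rw [Finset.sum_const, nsmul_eq_mul]
  clear_value w
  generalize dyadicBound w r K = F at *
  have full : ∀ s t, (if r < 4 * ((2 : ℝ) ^ s * 2 ^ t) then
      4 * ((2 : ℝ) ^ s * 2 ^ t * e s t / n) else 0) ≤ 4 * (F s t + F t s) := fun s t => by
    have h1 := hF0 s t
    have h2 := hF0 t s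
    split_ifs with h
    · rcases le_total (V s).card (V t).card with hc | hc
      · linarith [half s t h hc]
      · have := half t s (by rwa [mul_comm ((2 : ℝ) ^ t)]) hc
        rw [← hes, mul_comm ((2 : ℝ) ^ t)] at this
        linarith
    · positivity
  have hx0 : ∀ i, i ∉ T → x i = 0 := fun i hi => by simpa [T] using hi
  calc ∑ i, ∑ j, (if r < n * (|x i| * |x j|) then B i j * (|x i| * |x j|) else 0)
      = ∑ i ∈ T, ∑ j ∈ T, (if r < n * (|x i| * |x j|) then B i j * (|x i| * |x j|) else 0) := by
        rw [← Finset.sum_subset (Finset.subset_univ T)]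
        · refine Finset.sum_congr rfl fun i _ => ?_
          rw [← Finset.sum_subset (Finset.subset_univ T)]
          intro j _ hj
          simp [hx0 j hj]
        · intro i _ hi
          simp [hx0 i hi]
    _ = ∑ s ∈ S, ∑ t ∈ S, ∑ i ∈ V s, ∑ j ∈ V t,
          (if r < n * (|x i| * |x j|) then B i j * (|x i| * |x j|) else 0) := by
        rw [hfib]
        exact Finset.sum_congr rfl fun s _ =>
          (Finset.sum_congr rfl fun i _ => hfib _).trans Finset.sum_comm
    _ ≤ ∑ s ∈ S, ∑ t ∈ S, 4 * (F s t + F t s) := by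
        refine Finset.sum_le_sum fun s _ => Finset.sum_le_sum fun t _ => le_trans ?_ (full s t)
        split_ifs with h
        · simp only [e]
          rw [Finset.mul_sum, Finset.sum_div, Finset.mul_sum]
          refine Finset.sum_le_sum fun i hi => ?_
          rw [Finset.mul_sum, Finset.sum_div, Finset.mul_sum]
          refine Finset.sum_le_sum fun j hj => ?_
          obtain ⟨-, rfl⟩ := Finset.mem_filter.1 hi
          obtain ⟨-, rfl⟩ := Finset.mem_filter.1 hj
          have h0 := hB0 i j
          split_ifs
          · calc B i j * (|x i| * |x j|) = B i j * (n * (|x i| * |x j|)) / n := by field_simp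
              _ ≤ B i j * (4 * ((2 : ℝ) ^ l i * 2 ^ l j)) / n := by
                  exact div_le_div_of_nonneg_right
                    (mul_le_mul_of_nonneg_left (hprod i j) h0) hn'.le
              _ = _ := by ring
          · positivity
        · refine le_of_eq (Finset.sum_eq_zero fun i hi => Finset.sum_eq_zero fun j hj => ?_)
          obtain ⟨-, rfl⟩ := Finset.mem_filter.1 hi
          obtain ⟨-, rfl⟩ := Finset.mem_filter.1 hj
          exact if_neg fun h' => h (h'.trans_le (hprod i j))
    _ = 4 * (∑ s ∈ S, ∑ t ∈ S, F s t + ∑ s ∈ S, ∑ t ∈ S, F s t) := by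
        simp_rw [← Finset.mul_sum, Finset.sum_add_distrib]
        congr 2
        rw [Finset.sum_comm]
    _ ≤ 240 * K * r := by linarith

/-! ### Bernstein and Chernoff inequalities for weighted Bernoulli sums -/

/-- Since `(k + 2)! ≥ 2 * 3 ^ k`, the Taylor tail is dominated by a geometric series of ratio `b /
3`. -/
theorem Real.exp_le_one_add_add_sq_div {x b : ℝ} (hx : |x| ≤ b) (hb : b < 3) :
    Real.exp x ≤ 1 + x + x ^ 2 / 2 / (1 - b / 3) := by
  have hb0 : 0 ≤ b := (abs_nonneg x).trans hx
  have h1 : HasSum (fun k : ℕ => x ^ (k + 2) / (k + 2).factorial) (Real.exp x - (1 + x)) := by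
    have h := NormedSpace.expSeries_div_hasSum_exp x
    rw [← Real.exp_eq_exp_ℝ, ← hasSum_nat_add_iff' 2] at h
    simpa [Finset.sum_range_succ] using h
  have h2 : HasSum (fun k : ℕ => x ^ 2 / 2 * (b / 3) ^ k) (x ^ 2 / 2 * (1 - b / 3)⁻¹) :=
    (hasSum_geometric_of_lt_one (by positivity) (by linarith)).mul_left _
  have hfac : ∀ k : ℕ, (2 * 3 ^ k : ℝ) ≤ (k + 2).factorial := fun k => by
    induction k with
    | zero => simp
    | succ k ih =>
      rw [show k + 1 + 2 = (k + 2) + 1 by ring, Nat.factorial_succ]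
      push_cast at ih ⊢
      calc (2 * 3 ^ (k + 1) : ℝ) = 3 * (2 * 3 ^ k) := by ring
        _ ≤ ((k : ℝ) + 2 + 1) * (k + 2).factorial := by
          gcongr
          linarith [(Nat.cast_nonneg k : (0 : ℝ) ≤ k)]
  have := hasSum_le (fun k => ?_) h1 h2
  · rw [div_eq_mul_inv (x ^ 2 / 2)]
    linarith
  · calc x ^ (k + 2) / (k + 2).factorial ≤ |x| ^ (k + 2) / (k + 2).factorial := by
          refine div_le_div_of_nonneg_right ?_ (Nat.cast_nonneg _)
          rw [← abs_pow]
          exact le_abs_self _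
      _ ≤ |x| ^ (k + 2) / (2 * 3 ^ k) := by
          gcongr
          exact hfac k
      _ = x ^ 2 / 2 * (|x| / 3) ^ k := by
          rw [pow_add, sq_abs, div_pow]
          field_simp
      _ ≤ _ := by gcongr

section WeightedBernoulli

variable {Ω ι : Type*} [MeasurableSpace Ω] {μ : Measure Ω} [IsProbabilityMeasure μ] [Fintype ι]
  {X : ι → Ω → ℝ} {q : ι → unitInterval}

/-- Exponential Markov inequality for a weighted sum of independent Bernoulli variables. -/
theorem measureReal_weighted_bernoulli_ge_le (hX : iIndepFun X μ)
    (hlaw : ∀ e, HasLaw (X e) (bernoulliMeasure (1 : ℝ) 0 (q e)) μ) (w : ι → ℝ) {θ : ℝ}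
    (hθ : 0 ≤ θ) (s : ℝ) :
    μ.real {ω | s ≤ ∑ e, w e * X e ω} ≤
      Real.exp (-θ * s + ∑ e, (q e : ℝ) * (Real.exp (θ * w e) - 1)) := by
  have hmgf : mgf (fun ω => ∑ e, w e * X e ω) μ θ =
      ∏ e, (1 + (q e : ℝ) * (Real.exp (θ * w e) - 1)) := by
    have h := hX.integral_fun_prod_comp (f := fun e x => Real.exp (θ * (w e * x)))
      (fun e => (hlaw e).aemeasurable) fun e => by fun_prop
    rw [mgf]
    calc _ = ∫ ω, ∏ e, Real.exp (θ * (w e * X e ω)) ∂μ := by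
          simp_rw [Finset.mul_sum, Real.exp_sum]
      _ = _ := h
      _ = _ := by
          refine Finset.prod_congr rfl fun e _ => ?_
          have h' := (hlaw e).integral_comp (f := fun x => Real.exp (θ * (w e * x)))
            (by fun_prop)
          simp only [Function.comp_def] at h'
          rw [h', integral_bernoulliMeasure]
          simp only [mul_one, mul_zero, Real.exp_zero, smul_eq_mul]
          ring
  have hpos : 0 < ∏ e, (1 + (q e : ℝ) * (Real.exp (θ * w e) - 1)) := by
    refine Finset.prod_pos fun e _ => ?_
    have h0 := (q e).2.1
    have h1 := (q e).2.2
    rcases h0.eq_or_lt with h | h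
    · rw [← h]
      norm_num
    · nlinarith [Real.exp_pos (θ * w e)]
  -- A non-integrable function has integral 0 by convention, so a positive value of the integral
  -- forces integrability.
  have hint : Integrable (fun ω => Real.exp (θ * ∑ e, w e * X e ω)) μ :=
    Integrable.of_integral_ne_zero (by
      have := hmgf
      rw [mgf] at this
      rw [this]
      exact hpos.ne')
  refine (measure_ge_le_exp_mul_mgf s hθ hint).trans ?_
  rw [hmgf, Real.exp_add, Real.exp_sum]
  refine mul_le_mul_of_nonneg_left ?_ (Real.exp_pos _).le
  refine Finset.prod_le_prod (fun e _ => ?_) fun e _ => ?_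
  · have h0 := (q e).2.1
    have h1 := (q e).2.2
    nlinarith [Real.exp_pos (θ * w e)]
  · rw [add_comm]
    exact Real.add_one_le_exp _

/-- **Bernstein's inequality** for a weighted sum of independent Bernoulli variables. -/
theorem measureReal_weighted_bernoulli_bernstein (hX : iIndepFun X μ)
    (hlaw : ∀ e, HasLaw (X e) (bernoulliMeasure (1 : ℝ) 0 (q e)) μ) {w : ι → ℝ} {M V s : ℝ}
    (hw : ∀ e, |w e| ≤ M) (hM : 0 ≤ M) (hV : 0 < V) (hqV : ∑ e, (q e : ℝ) * w e ^ 2 ≤ V)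
    (hs : 0 ≤ s) :
    μ.real {ω | s + ∑ e, w e * (q e : ℝ) ≤ ∑ e, w e * X e ω} ≤
      Real.exp (-(s ^ 2 / 2) / (V + M * s / 3)) := by
  -- The exponential parameter will be `s / d`, for which `1 - (s / d) * M / 3 = V / d`.
  set d := V + M * s / 3 with hd
  have hd0 : 0 < d := by positivity
  have hθ : 0 ≤ s / d := by positivity
  refine (measureReal_weighted_bernoulli_ge_le hX hlaw w hθ _).trans (Real.exp_le_exp.2 ?_)
  have hMd : s / d * M < 3 := by
    rw [div_mul_eq_mul_div, div_lt_iff₀ hd0]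
    linarith
  have h1 : 1 - s / d * M / 3 = V / d := by
    field_simp
    rw [hd]
    ring
  have hterm : ∀ e, (q e : ℝ) * (Real.exp (s / d * w e) - 1) ≤
      s / d * (w e * q e) + (s ^ 2 / (2 * d * V)) * ((q e : ℝ) * w e ^ 2) := fun e => by
    have h2 := Real.exp_le_one_add_add_sq_div (x := s / d * w e) (b := s / d * M)
      (by rw [abs_mul, abs_of_nonneg hθ]; gcongr; exact hw e) hMd
    rw [h1] at h2
    have h3 : (s / d * w e) ^ 2 / 2 / (V / d) = (s ^ 2 / (2 * d * V)) * w e ^ 2 := by field_simp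
    rw [h3] at h2
    calc _ ≤ (q e : ℝ) * (s / d * w e + (s ^ 2 / (2 * d * V)) * w e ^ 2) :=
          mul_le_mul_of_nonneg_left (by linarith) (q e).2.1
      _ = _ := by ring
  have hsum := Finset.sum_le_sum fun e (_ : e ∈ Finset.univ) => hterm e
  rw [Finset.sum_add_distrib, ← Finset.mul_sum, ← Finset.mul_sum] at hsum
  have h4 : (s ^ 2 / (2 * d * V)) * ∑ e, (q e : ℝ) * w e ^ 2 ≤ (s ^ 2 / (2 * d * V)) * V := by
    gcongr
  have h5 : (s ^ 2 / (2 * d * V)) * V = s ^ 2 / (2 * d) := by field_simp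
  have h6 : -(s / d) * s + s ^ 2 / (2 * d) = -(s ^ 2 / 2) / d := by field_simp; ring
  linarith

/-- **Chernoff's inequality** for a sum of independent Bernoulli variables with weights in
`[0, 2]`. -/
theorem measureReal_weighted_bernoulli_chernoff (hX : iIndepFun X μ)
    (hlaw : ∀ e, HasLaw (X e) (bernoulliMeasure (1 : ℝ) 0 (q e)) μ) {w : ι → ℝ} {m l : ℝ}
    (hw0 : ∀ e, 0 ≤ w e) (hw2 : ∀ e, w e ≤ 2) (hqm : ∑ e, (q e : ℝ) * w e ≤ m)
    (hl : Real.exp 2 ≤ l) :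
    μ.real {ω | l * m ≤ ∑ e, w e * X e ω} ≤ Real.exp (-(m / 4) * (l * Real.log l)) := by
  have hl0 : 0 < l := (Real.exp_pos _).trans_le hl
  have hl1 : 1 ≤ l := (Real.one_le_exp zero_le_two).trans hl
  have hlog : 2 ≤ Real.log l := (Real.le_log_iff_exp_le hl0).2 hl
  have hm : 0 ≤ m := (Finset.sum_nonneg fun e _ => mul_nonneg (q e).2.1 (hw0 e)).trans hqm
  -- With this parameter the exponential equals 1 at weight 0 and `l` at weight 2, and convexity
  -- puts it below the chord in between.
  refine (measureReal_weighted_bernoulli_ge_le hX hlaw w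
    (θ := Real.log l / 2) (by linarith) _).trans (Real.exp_le_exp.2 ?_)
  have hterm : ∀ e, (q e : ℝ) * (Real.exp (Real.log l / 2 * w e) - 1) ≤
      (l - 1) / 2 * ((q e : ℝ) * w e) := fun e => by
    have h := convexOn_exp.2 (Set.mem_univ (Real.log l)) (Set.mem_univ 0)
      (by linarith [hw0 e] : 0 ≤ w e / 2) (by linarith [hw2 e] : 0 ≤ 1 - w e / 2) (by ring)
    simp only [smul_eq_mul, mul_zero, add_zero, Real.exp_zero, mul_one, Real.exp_log hl0] at h
    rw [show Real.log l / 2 * w e = w e / 2 * Real.log l by ring]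
    calc _ ≤ (q e : ℝ) * ((l - 1) / 2 * w e) :=
          mul_le_mul_of_nonneg_left (by linarith) (q e).2.1
      _ = _ := by ring
  have hsum := Finset.sum_le_sum fun e (_ : e ∈ Finset.univ) => hterm e
  rw [← Finset.mul_sum] at hsum
  have h1 : (l - 1) / 2 * ∑ e, (q e : ℝ) * w e ≤ (l - 1) / 2 * m :=
    mul_le_mul_of_nonneg_left hqm (by linarith)
  have h2 : m * (2 * l) ≤ m * (l * Real.log l) := by
    refine mul_le_mul_of_nonneg_left ?_ hm
    nlinarith
  linarith

end WeightedBernoulli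

/-! ### Nets of the sphere and the spectral norm -/

/-- A `1/3`-separated set in the unit ball has at most `7 ^ d` points. -/
theorem card_le_seven_pow_of_separated {E : Type*} [NormedAddCommGroup E] [NormedSpace ℝ E]
    [FiniteDimensional ℝ E] {s : Finset E} (hs : ∀ c ∈ s, ‖c‖ ≤ 1)
    (h : ∀ c ∈ s, ∀ d ∈ s, c ≠ d → 1 / 3 ≤ ‖c - d‖) : s.card ≤ 7 ^ Module.finrank ℝ E := by
  borelize E
  let ν : Measure E := Measure.addHaar
  -- Volume comparison: disjoint balls of radius `1/6` inside a ball of radius `7/6`.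
  have hD : Set.Pairwise (s : Set E)
      (Function.onFun Disjoint fun c => Metric.ball (c : E) (1 / 6 : ℝ)) := by
    rintro c hc d hd hcd
    apply Metric.ball_disjoint_ball
    rw [dist_eq_norm]
    linarith [h c hc d hd hcd]
  have hsub : (⋃ c ∈ s, Metric.ball (c : E) (1 / 6 : ℝ)) ⊆ Metric.ball (0 : E) (7 / 6 : ℝ) := by
    refine Set.iUnion₂_subset fun x hx => Metric.ball_subset_ball' ?_
    rw [dist_zero_right]
    linarith [hs x hx]
  have hI : (s.card : ENNReal) * ENNReal.ofReal ((1 / 6 : ℝ) ^ Module.finrank ℝ E) *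
      ν (Metric.ball 0 1) ≤
        ENNReal.ofReal ((7 / 6 : ℝ) ^ Module.finrank ℝ E) * ν (Metric.ball 0 1) :=
    calc _ = ν (⋃ c ∈ s, Metric.ball (c : E) (1 / 6 : ℝ)) := by
          rw [measure_biUnion_finset hD fun c _ => measurableSet_ball]
          simp only [ν.addHaar_ball_of_pos _ (by norm_num : (0 : ℝ) < 1 / 6)]
          simp only [Finset.sum_const, nsmul_eq_mul, mul_assoc]
      _ ≤ ν (Metric.ball (0 : E) (7 / 6 : ℝ)) := measure_mono hsub
      _ = _ := ν.addHaar_ball_of_pos _ (by norm_num)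
  have hJ := (ENNReal.mul_le_mul_iff_left (Metric.measure_ball_pos _ _ zero_lt_one).ne'
    measure_ball_lt_top.ne).1 hI
  have hK := ENNReal.toReal_le_of_le_ofReal (by positivity) hJ
  rw [ENNReal.toReal_mul, ENNReal.toReal_natCast, ENNReal.toReal_ofReal (by positivity)] at hK
  have h7 : (7 / 6 : ℝ) ^ Module.finrank ℝ E =
      7 ^ Module.finrank ℝ E * (1 / 6 : ℝ) ^ Module.finrank ℝ E := by
    rw [← mul_pow]
    norm_num
  rw [h7] at hK
  exact_mod_cast le_of_mul_le_mul_right hK (by positivity)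

/-- The unit sphere has a `1/3`-net with at most `7 ^ d` points. -/
theorem exists_sphere_net (E : Type*) [NormedAddCommGroup E] [NormedSpace ℝ E]
    [FiniteDimensional ℝ E] :
    ∃ N : Finset E, N.card ≤ 7 ^ Module.finrank ℝ E ∧ (∀ y ∈ N, ‖y‖ = 1) ∧
      ∀ x : E, ‖x‖ = 1 → ∃ y ∈ N, ‖x - y‖ ≤ 1 / 3 := by
  classical
  -- A separated set of maximal cardinality is a net: a point far from it could be added.
  let p : ℕ → Prop := fun k => ∃ N : Finset E, N.card = k ∧ (∀ y ∈ N, ‖y‖ = 1) ∧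
    ∀ c ∈ N, ∀ d ∈ N, c ≠ d → 1 / 3 ≤ ‖c - d‖
  have hp : ∀ k, p k → k ≤ 7 ^ Module.finrank ℝ E := by
    rintro k ⟨N, rfl, h1, h2⟩
    exact card_le_seven_pow_of_separated (fun c hc => (h1 c hc).le) h2
  have h0 : p 0 := ⟨∅, by simp⟩
  obtain ⟨N, hN, h1, h2⟩ := Nat.findGreatest_spec (P := p) (Nat.zero_le _) h0
  refine ⟨N, hN ▸ Nat.findGreatest_le _, h1, fun x hx => ?_⟩
  by_contra! hfar
  have hxN : x ∉ N := fun hxN => by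
    have := hfar x hxN
    norm_num at this
  have hp1 : p (N.card + 1) := by
    refine ⟨insert x N, Finset.card_insert_of_notMem hxN, ?_, ?_⟩
    · intro y hy
      rcases Finset.mem_insert.1 hy with rfl | hy
      exacts [hx, h1 y hy]
    · intro c hc d hd hcd
      rcases Finset.mem_insert.1 hc with hc' | hc' <;> rcases Finset.mem_insert.1 hd with hd' | hd'
      · exact absurd (hc'.trans hd'.symm) hcd
      · exact hc' ▸ (hfar d hd').le
      · rw [norm_sub_rev]
        exact hd' ▸ (hfar c hc').le
      · exact h2 c hc' d hd' hcd
  have := Nat.le_findGreatest (hp _ hp1) hp1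
  lia

/-- The operator norm of a symmetric operator is controlled by its quadratic form on a net. -/
theorem norm_le_of_sphere_net {E : Type*} [NormedAddCommGroup E] [InnerProductSpace ℝ E]
    {T : E →L[ℝ] E} (hT : T.IsSymmetric) {N : Finset E} (hN1 : ∀ y ∈ N, ‖y‖ = 1)
    (hN : ∀ x : E, ‖x‖ = 1 → ∃ y ∈ N, ‖x - y‖ ≤ 1 / 3) {b : ℝ} (hb0 : 0 ≤ b)
    (hb : ∀ y ∈ N, |inner ℝ (T y) y| ≤ b) : ‖T‖ ≤ 3 * b := by
  -- Moving to the nearest net point in each of the two arguments costs `‖T‖ / 3`; the total is then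
  -- absorbed on the left.
  suffices h : ‖T‖ ≤ b + 2 / 3 * ‖T‖ by linarith
  conv_lhs => rw [T.norm_eq_iSup_rayleighQuotient hT]
  refine ciSup_le fun x => ?_
  have hR : 0 ≤ b + 2 / 3 * ‖T‖ := by positivity
  rcases eq_or_ne x 0 with rfl | hx
  · simpa using hR
  have hx0 : 0 < ‖x‖ := norm_pos_iff.2 hx
  let z : E := ‖x‖⁻¹ • x
  have hz : ‖z‖ = 1 := by simp [z, norm_smul, hx0.ne']
  have hxz : T.rayleighQuotient x = inner ℝ (T z) z := by
    rw [← T.rayleigh_smul x (c := ‖x‖⁻¹) (inv_ne_zero hx0.ne')]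
    change T.reApplyInnerSelf z / ‖z‖ ^ 2 = _
    rw [hz]
    simp [ContinuousLinearMap.reApplyInnerSelf_apply]
  rw [hxz]
  obtain ⟨y, hy, hzy⟩ := hN z hz
  have hsplit : inner ℝ (T z) z = inner ℝ (T y) y + inner ℝ (T (z - y)) z
      + inner ℝ (T y) (z - y) := by
    simp only [map_sub, inner_sub_left, inner_sub_right]
    ring
  have e1 : |inner ℝ (T (z - y)) z| ≤ 1 / 3 * ‖T‖ := by
    refine (abs_real_inner_le_norm _ _).trans ?_
    rw [hz, mul_one, mul_comm]
    exact (T.le_opNorm _).trans (by gcongr)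
  have e2 : |inner ℝ (T y) (z - y)| ≤ 1 / 3 * ‖T‖ := by
    refine (abs_real_inner_le_norm _ _).trans ?_
    have := T.le_opNorm y
    rw [hN1 y hy, mul_one] at this
    rw [mul_comm]
    exact mul_le_mul hzy this (norm_nonneg _) (by norm_num)
  rw [hsplit]
  refine (abs_add_three _ _ _).trans ?_
  linarith [hb y hy]

theorem inner_toEuclideanCLM_self {n : ℕ} (M : Matrix (Fin n) (Fin n) ℝ)
    (y : EuclideanSpace ℝ (Fin n)) :
    inner ℝ (Matrix.toEuclideanCLM (n := Fin n) (𝕜 := ℝ) M y) y =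
      ∑ i, ∑ j, y i * y j * M i j := by
  simp only [PiLp.inner_apply, Matrix.ofLp_toEuclideanCLM, Matrix.mulVec, dotProduct]
  refine Finset.sum_congr rfl fun i _ => ?_
  simp only [RCLike.inner_apply, conj_trivial, Finset.mul_sum]
  exact Finset.sum_congr rfl fun j _ => by ring

/-- There are `7 ^ n` unit vectors such that the spectral norm of every symmetric matrix is at most
three times the maximum of its quadratic form over them. -/
theorem exists_matrixSpectralNorm_net (n : ℕ) :
    ∃ N : Finset (EuclideanSpace ℝ (Fin n)), N.card ≤ 7 ^ n ∧ (∀ y ∈ N, ∑ i, y i ^ 2 = 1) ∧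
      ∀ M : Matrix (Fin n) (Fin n) ℝ, (∀ i j, M j i = M i j) → ∀ b : ℝ, 0 ≤ b →
        (∀ y ∈ N, |∑ i, ∑ j, y i * y j * M i j| ≤ b) → matrixSpectralNorm M ≤ 3 * b := by
  obtain ⟨N, h1, h2, h3⟩ := exists_sphere_net (EuclideanSpace ℝ (Fin n))
  rw [finrank_euclideanSpace_fin] at h1
  refine ⟨N, h1, fun y hy => ?_, fun M hM b hb0 hb => ?_⟩
  · rw [← EuclideanSpace.real_norm_sq_eq, h2 y hy, one_pow]
  · refine norm_le_of_sphere_net ?_ h2 h3 hb0 fun y hy => ?_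
    · intro x y
      simp only [ContinuousLinearMap.coe_coe, PiLp.inner_apply,
        Matrix.ofLp_toEuclideanCLM, Matrix.mulVec, dotProduct,
        RCLike.inner_apply, conj_trivial, Finset.mul_sum, Finset.sum_mul]
      rw [Finset.sum_comm]
      refine Finset.sum_congr rfl fun i _ => Finset.sum_congr rfl fun j _ => ?_
      rw [hM]
      ring
    · rw [inner_toEuclideanCLM_self]
      exact hb y hy

/-! ### Reduction to the independent entries above the diagonal -/

theorem sum_subtype_lt_eq {n : ℕ} (f : Fin n → Fin n → ℝ) :
    ∑ q : {q : Fin n × Fin n // q.1 < q.2}, f q.1.1 q.1.2 =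
      ∑ i, ∑ j, if i < j then f i j else 0 := by
  rw [← Fintype.sum_prod_type' (f := fun i j => if i < j then f i j else 0), ← Finset.sum_filter]
  exact (Finset.sum_subtype (p := fun q : Fin n × Fin n => q.1 < q.2) _ (by simp)
    fun q => f q.1 q.2).symm

/-- A sum over all pairs of indices of entries of a symmetric matrix with zero diagonal, as a sum
over the entries above the diagonal. -/
theorem sum_mul_eq_sum_lt {n : ℕ} {F : Fin n → Fin n → ℝ} (hs : ∀ i j, F j i = F i j)
    (hd : ∀ i, F i i = 0) (W : Fin n → Fin n → ℝ) :
    ∑ i, ∑ j, W i j * F i j =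
      ∑ q : {q : Fin n × Fin n // q.1 < q.2},
        (W q.1.1 q.1.2 + W q.1.2 q.1.1) * F q.1.1 q.1.2 := by
  rw [sum_subtype_lt_eq fun i j => (W i j + W j i) * F i j]
  calc ∑ i, ∑ j, W i j * F i j
      = ∑ i, ∑ j, (if i < j then W i j * F i j else 0)
        + ∑ i, ∑ j, (if j < i then W i j * F i j else 0) := by
        simp_rw [← Finset.sum_add_distrib]
        refine Finset.sum_congr rfl fun i _ => Finset.sum_congr rfl fun j _ => ?_
        rcases lt_trichotomy i j with h | rfl | h
        · simp [h, h.not_gt]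
        · simp [hd]
        · simp [h, h.not_gt]
    _ = _ := by
        rw [Finset.sum_comm (f := fun i j => if j < i then W i j * F i j else 0)]
        simp_rw [← Finset.sum_add_distrib]
        refine Finset.sum_congr rfl fun i _ => Finset.sum_congr rfl fun j _ => ?_
        rw [hs i j]
        split_ifs <;> ring

theorem sum_subtype_lt_add_le {n : ℕ} {f : Fin n → Fin n → ℝ} (hf : ∀ i j, 0 ≤ f i j) :
    ∑ q : {q : Fin n × Fin n // q.1 < q.2}, (f q.1.1 q.1.2 + f q.1.2 q.1.1) ≤
      ∑ i, ∑ j, f i j := by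
  rw [sum_subtype_lt_eq fun i j => f i j + f j i]
  calc _ = ∑ i, ∑ j, (if i < j then f i j else 0) + ∑ i, ∑ j, (if j < i then f i j else 0) := by
        rw [Finset.sum_comm (f := fun i j => if j < i then f i j else 0)]
        simp_rw [← Finset.sum_add_distrib]
        refine Finset.sum_congr rfl fun i _ => Finset.sum_congr rfl fun j _ => ?_
        split_ifs <;> ring
    _ ≤ _ := by
        simp_rw [← Finset.sum_add_distrib]
        refine Finset.sum_le_sum fun i _ => Finset.sum_le_sum fun j _ => ?_
        have := hf i j
        split_ifs with h1 h2
        · exact absurd h1 h2.not_gt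
        all_goals linarith

theorem sum_subtype_lt_sq_le {n : ℕ} (W : Fin n → Fin n → ℝ) :
    ∑ q : {q : Fin n × Fin n // q.1 < q.2}, (W q.1.1 q.1.2 + W q.1.2 q.1.1) ^ 2 ≤
      2 * ∑ i, ∑ j, W i j ^ 2 := by
  have h := sum_subtype_lt_add_le (f := fun i j => 2 * W i j ^ 2) fun i j => by positivity
  simp_rw [← Finset.mul_sum] at h
  refine le_trans (Finset.sum_le_sum fun q _ => ?_) h
  linarith [sq_nonneg (W q.1.1 q.1.2 - W q.1.2 q.1.1)]

/-- The coefficients of the entries above the diagonal in the sum of all entries of the smoothed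
matrix, weighted by `W`. -/
def pairWeight {t n : ℕ} (β : Fin (t + 1) → ℝ) (W : Fin n → Fin n → ℝ)
    (e : Fin (t + 1) × {q : Fin n × Fin n // q.1 < q.2}) : ℝ :=
  β e.1.rev * (W e.2.1.1 e.2.1.2 + W e.2.1.2 e.2.1.1)

theorem smoothedMatrix_apply {Ω : Type*} {t n : ℕ} (β : Fin (t + 1) → ℝ)
    (A : Fin (t + 1) → Ω → Matrix (Fin n) (Fin n) ℝ) (ω : Ω) (i j : Fin n) :
    smoothedMatrix β A ω i j = ∑ k, β k.rev * A k ω i j := by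
  rw [smoothedMatrix, Matrix.sum_apply, ← Equiv.sum_comp Fin.revPerm]
  simp

/-! ### Mean and concentration of the smoothed matrix -/

section Model

variable {Ω : Type*} [MeasurableSpace Ω] {μ : Measure Ω} {t n : ℕ}
  {A : Fin (t + 1) → Ω → Matrix (Fin n) (Fin n) ℝ} {p : Fin (t + 1) → Fin n → Fin n → unitInterval}
  {α : ℝ} {β : Fin (t + 1) → ℝ} {βmax Cβ Cβ' ε : ℝ}

theorem IsSymmBernoulliFamily.smoothedMatrix_symm (h : IsSymmBernoulliFamily μ A p)
    (β : Fin (t + 1) → ℝ) (ω : Ω) (i j : Fin n) :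
    smoothedMatrix β A ω j i = smoothedMatrix β A ω i j := by
  simp_rw [smoothedMatrix_apply, h.symm]

theorem IsSymmBernoulliFamily.smoothedMatrix_diag (h : IsSymmBernoulliFamily μ A p)
    (β : Fin (t + 1) → ℝ) (ω : Ω) (i : Fin n) : smoothedMatrix β A ω i i = 0 := by
  simp [smoothedMatrix_apply, h.diag]

theorem IsSymmBernoulliFamily.matrixExpectation_symm (h : IsSymmBernoulliFamily μ A p)
    (β : Fin (t + 1) → ℝ) (i j : Fin n) :
    matrixExpectation μ (smoothedMatrix β A) j i =
      matrixExpectation μ (smoothedMatrix β A) i j := by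
  simp only [matrixExpectation, Matrix.of_apply, h.smoothedMatrix_symm β _ i j]

theorem IsSymmBernoulliFamily.matrixExpectation_diag (h : IsSymmBernoulliFamily μ A p)
    (β : Fin (t + 1) → ℝ) (i : Fin n) : matrixExpectation μ (smoothedMatrix β A) i i = 0 := by
  simp [matrixExpectation, h.smoothedMatrix_diag]

theorem IsSymmBernoulliFamily.matrixExpectation_apply (h : IsSymmBernoulliFamily μ A p)
    (β : Fin (t + 1) → ℝ) {i j : Fin n} (hij : i ≠ j) :
    matrixExpectation μ (smoothedMatrix β A) i j = ∑ k, β k.rev * (p k i j : ℝ) := by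
  have hint : ∀ k, Integrable (fun ω => A k ω i j) μ := fun k => by
    have h1 : Integrable (id : ℝ → ℝ) (bernoulliMeasure (1 : ℝ) 0 (p k i j)) := by
      rw [bernoulliMeasure_def]
      exact .add_measure (integrable_dirac (by simp)).smul_measure_nnreal
        (integrable_dirac (by simp)).smul_measure_nnreal
    rw [← (h.law k i j hij).map_eq] at h1
    exact h1.comp_aemeasurable (h.law k i j hij).aemeasurable
  simp only [matrixExpectation, Matrix.of_apply, smoothedMatrix_apply]
  rw [integral_finsetSum _ fun k _ => (hint k).const_mul _]
  refine Finset.sum_congr rfl fun k _ => ?_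
  rw [integral_const_mul, (h.law k i j hij).integral_eq, integral_bernoulliMeasure]
  simp

theorem SmoothingWeights.sum_rev (hβ : SmoothingWeights β βmax Cβ Cβ' ε) :
    ∑ k : Fin (t + 1), β k.rev = 1 := by
  rw [← hβ.sum_eq_one]
  exact Equiv.sum_comp Fin.revPerm β

theorem SmoothingWeights.sum_sq_rev_le (hβ : SmoothingWeights β βmax Cβ Cβ' ε) :
    ∑ k : Fin (t + 1), β k.rev ^ 2 ≤ Cβ * βmax := by
  refine le_trans (le_of_eq ?_) hβ.sum_sq_le
  exact Equiv.sum_comp Fin.revPerm fun k => β k ^ 2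

theorem IsSymmBernoulliFamily.matrixExpectation_nonneg (h : IsSymmBernoulliFamily μ A p)
    (hβ : SmoothingWeights β βmax Cβ Cβ' ε) (i j : Fin n) :
    0 ≤ matrixExpectation μ (smoothedMatrix β A) i j := by
  rcases eq_or_ne i j with rfl | hij
  · rw [h.matrixExpectation_diag]
  · rw [h.matrixExpectation_apply β hij]
    exact Finset.sum_nonneg fun k _ => mul_nonneg (hβ.nonneg _) (p k i j).2.1

theorem IsSymmBernoulliFamily.matrixExpectation_le (h : IsSymmBernoulliFamily μ A p)
    (hα : 0 ≤ α) (hp : ∀ k i j, i ≠ j → (p k i j : ℝ) ≤ α)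
    (hβ : SmoothingWeights β βmax Cβ Cβ' ε) (i j : Fin n) :
    matrixExpectation μ (smoothedMatrix β A) i j ≤ α := by
  rcases eq_or_ne i j with rfl | hij
  · rwa [h.matrixExpectation_diag]
  · rw [h.matrixExpectation_apply β hij]
    calc _ ≤ ∑ k : Fin (t + 1), β k.rev * α := Finset.sum_le_sum fun k _ =>
          mul_le_mul_of_nonneg_left (hp k i j hij) (hβ.nonneg _)
      _ = α := by rw [← Finset.sum_mul, hβ.sum_rev, one_mul]

/-- The entries are known only through their law, so they are non-negative only almost surely. -/
theorem IsSymmBernoulliFamily.ae_smoothedMatrix_nonneg (h : IsSymmBernoulliFamily μ A p)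
    (hβ : SmoothingWeights β βmax Cβ Cβ' ε) :
    ∀ᵐ ω ∂μ, ∀ i j, 0 ≤ smoothedMatrix β A ω i j := by
  have h1 : ∀ᵐ ω ∂μ, ∀ k i j, 0 ≤ A k ω i j := by
    refine ae_all_iff.2 fun k => ae_all_iff.2 fun i => ae_all_iff.2 fun j => ?_
    rcases eq_or_ne i j with rfl | hij
    · exact ae_of_all _ fun ω => (h.diag k ω i).ge
    · rw [(h.law k i j hij).ae_iff (p := fun x => 0 ≤ x)
        (measurableSet_setOfPred.1 measurableSet_Ici), bernoulliMeasure_def]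
      refine ae_add_measure_iff.2 ⟨Measure.ae_smul_measure ?_ _, Measure.ae_smul_measure ?_ _⟩
      · exact (ae_dirac_iff measurableSet_Ici).2 zero_le_one
      · exact (ae_dirac_iff measurableSet_Ici).2 le_rfl
  filter_upwards [h1] with ω hω i j
  rw [smoothedMatrix_apply]
  exact Finset.sum_nonneg fun k _ => mul_nonneg (hβ.nonneg _) (hω k i j)

theorem sum_mul_sum_eq_sum_pairWeight (β : Fin (t + 1) → ℝ) (W : Fin n → Fin n → ℝ)
    (F : Fin (t + 1) → Fin n → Fin n → ℝ) :
    ∑ q : {q : Fin n × Fin n // q.1 < q.2},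
        (W q.1.1 q.1.2 + W q.1.2 q.1.1) * ∑ k, β k.rev * F k q.1.1 q.1.2 =
      ∑ e, pairWeight β W e * F e.1 e.2.1.1 e.2.1.2 := by
  rw [Fintype.sum_prod_type, Finset.sum_comm]
  refine Finset.sum_congr rfl fun q _ => ?_
  rw [Finset.mul_sum]
  refine Finset.sum_congr rfl fun k _ => ?_
  simp only [pairWeight]
  ring

theorem IsSymmBernoulliFamily.sum_mul_smoothedMatrix (h : IsSymmBernoulliFamily μ A p)
    (β : Fin (t + 1) → ℝ) (W : Fin n → Fin n → ℝ) (ω : Ω) :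
    ∑ i, ∑ j, W i j * smoothedMatrix β A ω i j =
      ∑ e, pairWeight β W e * A e.1 ω e.2.1.1 e.2.1.2 := by
  rw [sum_mul_eq_sum_lt (h.smoothedMatrix_symm β ω) (h.smoothedMatrix_diag β ω),
    ← sum_mul_sum_eq_sum_pairWeight β W fun k i j => A k ω i j]
  simp_rw [smoothedMatrix_apply]

theorem IsSymmBernoulliFamily.sum_mul_matrixExpectation (h : IsSymmBernoulliFamily μ A p)
    (β : Fin (t + 1) → ℝ) (W : Fin n → Fin n → ℝ) :
    ∑ i, ∑ j, W i j * matrixExpectation μ (smoothedMatrix β A) i j =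
      ∑ e, pairWeight β W e * (p e.1 e.2.1.1 e.2.1.2 : ℝ) := by
  rw [sum_mul_eq_sum_lt (h.matrixExpectation_symm β) (h.matrixExpectation_diag β),
    ← sum_mul_sum_eq_sum_pairWeight β W fun k i j => (p k i j : ℝ)]
  refine Finset.sum_congr rfl fun q _ => ?_
  rw [h.matrixExpectation_apply β q.2.ne]

variable [IsProbabilityMeasure μ]

/-- Bernstein's inequality for a weighted sum of the entries of the smoothed matrix. -/
theorem IsSymmBernoulliFamily.bernstein (h : IsSymmBernoulliFamily μ A p) (hα : 0 < α)
    (hp : ∀ k i j, i ≠ j → (p k i j : ℝ) ≤ α) (hβ : SmoothingWeights β βmax Cβ Cβ' ε)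
    {W : Fin n → Fin n → ℝ} {M v s : ℝ} (hM : 0 ≤ M) (hWM : ∀ i j, i < j → |W i j + W j i| ≤ M)
    (hv : 0 < v) (hWv : ∑ q : {q : Fin n × Fin n // q.1 < q.2},
      (W q.1.1 q.1.2 + W q.1.2 q.1.1) ^ 2 ≤ v) (hs : 0 ≤ s) :
    μ.real {ω | s + ∑ i, ∑ j, W i j * matrixExpectation μ (smoothedMatrix β A) i j ≤
      ∑ i, ∑ j, W i j * smoothedMatrix β A ω i j} ≤
      Real.exp (-(s ^ 2 / 2) / (Cβ * βmax * α * v + βmax * M * s / 3)) := by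
  have h1 := hβ.Cβ_pos
  have h2 := hβ.βmax_pos
  simp_rw [h.sum_mul_matrixExpectation, h.sum_mul_smoothedMatrix]
  refine measureReal_weighted_bernoulli_bernstein h.indep
    (fun e => h.law e.1 _ _ e.2.2.ne) (fun e => ?_) (by positivity) (by positivity) ?_ hs
  · rw [pairWeight, abs_mul, abs_of_nonneg (hβ.nonneg _)]
    exact mul_le_mul (hβ.le_max _) (hWM _ _ e.2.2) (abs_nonneg _) h2.le
  · calc _ ≤ ∑ e : Fin (t + 1) × {q : Fin n × Fin n // q.1 < q.2},
          α * (β e.1.rev ^ 2 * (W e.2.1.1 e.2.1.2 + W e.2.1.2 e.2.1.1) ^ 2) := by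
          refine Finset.sum_le_sum fun e _ => ?_
          rw [pairWeight, mul_pow]
          exact mul_le_mul_of_nonneg_right (hp _ _ _ e.2.2.ne) (by positivity)
      _ = α * ((∑ k : Fin (t + 1), β k.rev ^ 2) * ∑ q : {q : Fin n × Fin n // q.1 < q.2},
          (W q.1.1 q.1.2 + W q.1.2 q.1.1) ^ 2) := by
          rw [Fintype.sum_prod_type, Finset.sum_mul_sum]
          simp_rw [Finset.mul_sum]
      _ ≤ α * ((Cβ * βmax) * v) := by
          gcongr
          exact hβ.sum_sq_rev_le
      _ = _ := by ring

/-- Chernoff's inequality for a block sum of the smoothed matrix. -/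
theorem IsSymmBernoulliFamily.chernoff (h : IsSymmBernoulliFamily μ A p) (hα : 0 ≤ α)
    (hp : ∀ k i j, i ≠ j → (p k i j : ℝ) ≤ α) (hβ : SmoothingWeights β βmax Cβ Cβ' ε)
    (I J : Finset (Fin n)) {l : ℝ} (hl : Real.exp 2 ≤ l) :
    μ.real {ω | l * (I.card * J.card * (α / βmax)) ≤
      ∑ i ∈ I, ∑ j ∈ J, smoothedMatrix β A ω i j / βmax} ≤
      Real.exp (-(I.card * J.card * (α / βmax) / 4) * (l * Real.log l)) := by
  have hb := hβ.βmax_pos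
  -- When `I` and `J` overlap, an entry above the diagonal may be counted twice; hence weights up to
  -- 2.
  let W : Fin n → Fin n → ℝ := fun i j => if i ∈ I ∧ j ∈ J then 1 / βmax else 0
  have hW0 : ∀ i j, 0 ≤ W i j := fun i j => by
    simp only [W]
    split_ifs <;> positivity
  have hW1 : ∀ i j, W i j ≤ 1 / βmax := fun i j => by
    simp only [W]
    split_ifs
    · rfl
    · positivity
  have hsum : ∀ F : Fin n → Fin n → ℝ,
      ∑ i, ∑ j, W i j * F i j = ∑ i ∈ I, ∑ j ∈ J, F i j / βmax := fun F => by
    have h1 : ∀ i j, W i j * F i j = if i ∈ I then if j ∈ J then F i j / βmax else 0 else 0 :=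
      fun i j => by
        simp only [W]
        split_ifs with h1 h2 h3 h4
        all_goals first | tauto | ring
    simp_rw [h1]
    have h2 : ∀ i, (∑ j, if i ∈ I then if j ∈ J then F i j / βmax else 0 else 0) =
        if i ∈ I then ∑ j ∈ J, F i j / βmax else 0 := fun i => by
      split_ifs <;> simp
    simp_rw [h2]
    simp
  have hA : ∀ ω, ∑ i ∈ I, ∑ j ∈ J, smoothedMatrix β A ω i j / βmax =
      ∑ e, pairWeight β W e * A e.1 ω e.2.1.1 e.2.1.2 := fun ω =>
    (hsum _).symm.trans (h.sum_mul_smoothedMatrix β W ω)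
  simp_rw [hA]
  refine measureReal_weighted_bernoulli_chernoff h.indep
    (fun e => h.law e.1 _ _ e.2.2.ne) (fun e => ?_) (fun e => ?_) ?_ hl
  · exact mul_nonneg (hβ.nonneg _) (add_nonneg (hW0 _ _) (hW0 _ _))
  · calc pairWeight β W e ≤ βmax * (1 / βmax + 1 / βmax) :=
          mul_le_mul (hβ.le_max _) (add_le_add (hW1 _ _) (hW1 _ _))
            (add_nonneg (hW0 _ _) (hW0 _ _)) hb.le
      _ = 2 := by field_simp; norm_num
  · simp_rw [mul_comm _ (pairWeight β W _)]
    rw [← h.sum_mul_matrixExpectation]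
    refine (hsum _).trans_le ?_
    calc _ ≤ ∑ i ∈ I, ∑ j ∈ J, α / βmax := by
          refine Finset.sum_le_sum fun i _ => Finset.sum_le_sum fun j _ => ?_
          gcongr
          exact h.matrixExpectation_le hα hp hβ i j
      _ = _ := by simp only [Finset.sum_const, nsmul_eq_mul]; ring

end Model

/-! ### Discrepancy: tails and union bound over pairs of sets -/

/-- A random variable with tails `exp (-(m / 4) * (l * log l))` at `l * m`, `l ≥ e ^ 2`. -/
theorem measureReal_mul_log_ge_le {Ω : Type*} [MeasurableSpace Ω] {μ : Measure Ω}
    [IsFiniteMeasure μ] {X : Ω → ℝ} {m : ℝ} (hm : 0 < m)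
    (hX : ∀ l, Real.exp 2 ≤ l →
      μ.real {ω | l * m ≤ X ω} ≤ Real.exp (-(m / 4) * (l * Real.log l))) (y : ℝ) :
    μ.real {ω | Real.exp 2 * m ≤ X ω ∧ y ≤ X ω * Real.log (X ω / m)} ≤ Real.exp (-(y / 4)) := by
  have hmono : ∀ {a b : ℝ}, Real.exp 2 ≤ a → a < b → a * Real.log a < b * Real.log b :=
    fun {a b} ha hab => by
      have ha0 : 0 < a := (Real.exp_pos 2).trans_le ha
      have h1 : 0 < Real.log a :=
        Real.log_pos ((Real.one_lt_exp_iff.2 zero_lt_two).trans_le ha)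
      exact mul_lt_mul hab (Real.log_le_log ha0 hab.le) h1 (ha0.trans hab).le
  have he : Real.exp 2 * Real.log (Real.exp 2) = Real.exp 2 * 2 := by rw [Real.log_exp]
  -- The function `l log l` is increasing beyond `exp 2`, so the event is a tail event at its
  -- inverse. The maximum with `2 exp 2` covers small `y`, where `l = exp 2`.
  obtain ⟨l, hl, hly⟩ : ∃ l, Real.exp 2 ≤ l ∧
      l * Real.log l = max (Real.exp 2 * 2) (y / m) := by
    let b := max (Real.exp 2) (y / m)
    have hb : Real.exp 2 ≤ b := le_max_left _ _
    have hb0 : 0 < b := (Real.exp_pos 2).trans_le hb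
    have hcont : ContinuousOn (fun l : ℝ => l * Real.log l) (Set.Icc (Real.exp 2) b) :=
      Real.continuous_mul_log.continuousOn
    have h2 : 2 ≤ Real.log b := (Real.le_log_iff_exp_le hb0).2 hb
    have h3 : b * 2 ≤ b * Real.log b := by gcongr
    have h4 : y / m ≤ b := le_max_right _ _
    have hmem : max (Real.exp 2 * 2) (y / m) ∈
        Set.Icc (Real.exp 2 * Real.log (Real.exp 2)) (b * Real.log b) := by
      rw [he]
      refine ⟨le_max_left _ _, max_le (le_trans ?_ h3) (le_trans ?_ h3)⟩
      · gcongr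
      · linarith
    obtain ⟨l, hl, hl'⟩ := intermediate_value_Icc hb hcont hmem
    exact ⟨l, hl.1, hl'⟩
  refine le_trans (measureReal_mono ?_) ((hX l hl).trans (Real.exp_le_exp.2 ?_))
  · rintro ω ⟨h1, h2⟩
    by_contra hlt
    have hlt' : X ω / m < l := (div_lt_iff₀ hm).2 (not_le.1 hlt)
    have h3 : Real.exp 2 ≤ X ω / m := (le_div_iff₀ hm).2 h1
    have h4 := hmono h3 hlt'
    rw [hly, lt_max_iff] at h4
    rcases h4 with h4 | h4
    · rcases h3.eq_or_lt with h5 | h5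
      · rw [← h5, he] at h4
        exact h4.false
      · have := hmono le_rfl h5
        rw [he] at this
        linarith
    · rw [div_mul_eq_mul_div, div_lt_div_iff_of_pos_right hm] at h4
      linarith
  · have h1 : y / m ≤ l * Real.log l := hly ▸ le_max_right _ _
    rw [div_le_iff₀ hm] at h1
    linarith

/-- The function `x log(n/x)` increases up to `n / exp 1`; this is why only sets of at most that
size enter the union bound. -/
theorem mul_log_div_mono {n g h : ℝ} (hg : 0 < g) (hgh : g ≤ h) (hhn : Real.exp 1 * h ≤ n) :
    g * Real.log (n / g) ≤ h * Real.log (n / h) := by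
  have hh : 0 < h := hg.trans_le hgh
  have hn : 0 < n := (by positivity : 0 < Real.exp 1 * h).trans_le hhn
  have h1 : 1 ≤ Real.log (n / h) := by
    rw [Real.le_log_iff_exp_le (by positivity), le_div_iff₀ hh]
    exact hhn
  have h2 : Real.log (n / g) = Real.log (n / h) + Real.log (h / g) := by
    rw [← Real.log_mul (by positivity) (by positivity)]
    congr 1
    field_simp
  have h3 : g * Real.log (h / g) ≤ h - g := by
    have := Real.log_le_sub_one_of_pos (show 0 < h / g by positivity)
    calc _ ≤ g * (h / g - 1) := by gcongr
      _ = _ := by field_simp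
  rw [h2]
  nlinarith

theorem choose_le_exp_mul_log {n g : ℕ} (hg : 0 < g) (hgn : Real.exp 1 * g ≤ n) :
    (n.choose g : ℝ) ≤ Real.exp (2 * (g * Real.log (n / g))) := by
  have hg' : (0 : ℝ) < g := Nat.cast_pos.2 hg
  have hn' : (0 : ℝ) < n := (by positivity : 0 < Real.exp 1 * (g : ℝ)).trans_le hgn
  have h1 : 1 ≤ Real.log (n / g) := by
    rw [Real.le_log_iff_exp_le (by positivity), le_div_iff₀ hg']
    exact hgn
  calc (n.choose g : ℝ) ≤ (n : ℝ) ^ g / g.factorial := Nat.choose_le_pow_div g n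
    _ = ((n : ℝ) / g) ^ g * ((g : ℝ) ^ g / g.factorial) := by
        rw [div_pow]
        field_simp
    _ ≤ ((n : ℝ) / g) ^ g * Real.exp g := by
        gcongr
        exact Real.pow_div_factorial_le_exp _ hg'.le g
    _ = Real.exp (g * Real.log (n / g) + g) := by
        rw [Real.exp_add, Real.exp_nat_mul, Real.exp_log (by positivity)]
    _ ≤ _ := Real.exp_le_exp.2 (by nlinarith)

/-- The non-empty sets of at most `n / e` indices. -/
noncomputable def smallSets (n : ℕ) : Finset (Finset (Fin n)) :=
  open Classical in Finset.univ.filter fun J => J.Nonempty ∧ Real.exp 1 * J.card ≤ n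

theorem mem_smallSets {n : ℕ} {J : Finset (Fin n)} :
    J ∈ smallSets n ↔ J.Nonempty ∧ Real.exp 1 * J.card ≤ n := by
  simp [smallSets]

/-- The weight of a set is at most the inverse of the number of small sets of its size, so each size
contributes at most 1. -/
theorem sum_smallSets_exp_le (n : ℕ) :
    ∑ J ∈ smallSets n, Real.exp (-(2 * (J.card * Real.log (n / J.card)))) ≤ n := by
  have hmaps : ∀ J ∈ smallSets n, J.card ∈ Finset.Icc 1 n := fun J hJ =>
    Finset.mem_Icc.2 ⟨(mem_smallSets.1 hJ).1.card_pos,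
      (Finset.card_le_univ J).trans_eq (Fintype.card_fin n)⟩
  rw [← Finset.sum_fiberwise_of_maps_to hmaps]
  calc _ ≤ ∑ h ∈ Finset.Icc 1 n, (1 : ℝ) := by
        refine Finset.sum_le_sum fun h _ => ?_
        rcases ((smallSets n).filter fun J => J.card = h).eq_empty_or_nonempty with he | ⟨J, hJ⟩
        · simp [he]
        obtain ⟨hJs, rfl⟩ := Finset.mem_filter.1 hJ
        obtain ⟨hJ0, hJn⟩ := mem_smallSets.1 hJs
        have hcard : (((smallSets n).filter fun J' => J'.card = J.card).card : ℝ) ≤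
            n.choose J.card := by
          have : (smallSets n).filter (fun J' => J'.card = J.card) ⊆
              Finset.powersetCard J.card Finset.univ := fun J' hJ' =>
            Finset.mem_powersetCard.2 ⟨Finset.subset_univ _, (Finset.mem_filter.1 hJ').2⟩
          have := Finset.card_le_card this
          rw [Finset.card_powersetCard, Finset.card_univ, Fintype.card_fin] at this
          exact_mod_cast this
        calc _ = ∑ J' ∈ smallSets n with J'.card = J.card,
              Real.exp (-(2 * (J.card * Real.log (n / J.card)))) :=
              Finset.sum_congr rfl fun J' hJ' => by rw [(Finset.mem_filter.1 hJ').2]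
          _ ≤ Real.exp (2 * (J.card * Real.log (n / J.card))) *
              Real.exp (-(2 * (J.card * Real.log (n / J.card)))) := by
              rw [Finset.sum_const, nsmul_eq_mul]
              gcongr
              exact hcard.trans (choose_le_exp_mul_log hJ0.card_pos hJn)
          _ = 1 := by rw [← Real.exp_add, add_neg_cancel, Real.exp_zero]
    _ = n := by simp

/-- Union bound over pairs of small sets. -/
theorem sum_sum_smallSets_exp_le {n : ℕ} {c : ℝ} (hc : 16 ≤ c) :
    ∑ I ∈ smallSets n, ∑ J ∈ smallSets n with I.card ≤ J.card,
      Real.exp (-(c * (J.card * Real.log (n / J.card)) / 4)) ≤ (n : ℝ) ^ (-c / 4 + 6) := by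
  rcases Nat.eq_zero_or_pos n with rfl | hn
  · have : smallSets 0 = ∅ := Finset.eq_empty_of_forall_notMem fun J hJ => by
      obtain ⟨i, -⟩ := (mem_smallSets.1 hJ).1
      exact i.elim0
    rw [this, Finset.sum_empty]
    positivity
  have hn' : (0 : ℝ) < n := Nat.cast_pos.2 hn
  let f : Finset (Fin n) → ℝ := fun J => Real.exp (-(2 * (J.card * Real.log (n / J.card))))
  have hf : ∑ J ∈ smallSets n, f J ≤ n := sum_smallSets_exp_le n
  have hf0 : ∀ J, 0 ≤ f J := fun J => (Real.exp_pos _).le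
  -- Of the exponent `c / 4`, a share 4 pays for the weights `f I` and `f J` by monotonicity of `x
  -- log(n/x)`; the rest is compared with `log n`, its argument at `x = 1`. Each sum of `f` then
  -- costs a factor `n`, whence `4 + 2 = 6`.
  calc _ ≤ ∑ I ∈ smallSets n, ∑ J ∈ smallSets n with I.card ≤ J.card,
        (n : ℝ) ^ (4 - c / 4) * (f I * f J) := by
        refine Finset.sum_le_sum fun I hI => Finset.sum_le_sum fun J hJ => ?_
        obtain ⟨hJs, hIJ⟩ := Finset.mem_filter.1 hJ
        obtain ⟨hI0, hIn⟩ := mem_smallSets.1 hI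
        obtain ⟨hJ0, hJn⟩ := mem_smallSets.1 hJs
        have h1 : (1 : ℝ) ≤ I.card := Nat.one_le_cast.2 hI0.card_pos
        have h2 : (I.card : ℝ) ≤ J.card := Nat.cast_le.2 hIJ
        have h3 := mul_log_div_mono (by linarith) h2 hJn
        have h4 := mul_log_div_mono zero_lt_one (h1.trans h2) hJn
        rw [one_mul, div_one] at h4
        simp only [f]
        rw [Real.rpow_def_of_pos hn', ← Real.exp_add, ← Real.exp_add]
        refine Real.exp_le_exp.2 ?_
        nlinarith
    _ ≤ ∑ I ∈ smallSets n, ∑ J ∈ smallSets n, (n : ℝ) ^ (4 - c / 4) * (f I * f J) := by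
        refine Finset.sum_le_sum fun I _ => Finset.sum_le_sum_of_subset_of_nonneg
          (Finset.filter_subset _ _) fun J _ _ => ?_
        have := hf0 I
        have := hf0 J
        positivity
    _ = (n : ℝ) ^ (4 - c / 4) * ((∑ I ∈ smallSets n, f I) * ∑ J ∈ smallSets n, f J) := by
        rw [Finset.sum_mul_sum]
        simp_rw [Finset.mul_sum]
    _ ≤ (n : ℝ) ^ (4 - c / 4) * ((n : ℝ) * n) := by
        gcongr
    _ = (n : ℝ) ^ (4 - c / 4) * (n : ℝ) ^ (2 : ℝ) := by
        rw [Real.rpow_two, sq]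
    _ = _ := by
        rw [← Real.rpow_add hn']
        congr 1
        ring

/-! ### Light and heavy parts of the quadratic form -/

/-- The products `y i * y j` that are at most `r / n` in absolute value. -/
noncomputable def lightPart {n : ℕ} (r : ℝ) (y : Fin n → ℝ) (i j : Fin n) : ℝ :=
  if n * (|y i| * |y j|) ≤ r then y i * y j else 0

theorem abs_lightPart_le {n : ℕ} (hn : 0 < n) {r : ℝ} (hr : 0 ≤ r) (y : Fin n → ℝ)
    (i j : Fin n) : |lightPart r y i j| ≤ r / n := by
  unfold lightPart
  split_ifs with h
  · rw [abs_mul, le_div_iff₀ (Nat.cast_pos.2 hn)]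
    linarith
  · rw [abs_zero]
    positivity

theorem sum_lightPart_sq_le {n : ℕ} (r : ℝ) {y : Fin n → ℝ} (hy : ∑ i, y i ^ 2 = 1) :
    ∑ i, ∑ j, lightPart r y i j ^ 2 ≤ 1 := by
  calc _ ≤ ∑ i, ∑ j, y i ^ 2 * y j ^ 2 := by
        refine Finset.sum_le_sum fun i _ => Finset.sum_le_sum fun j _ => ?_
        unfold lightPart
        split_ifs
        · rw [mul_pow]
        · rw [zero_pow two_ne_zero]
          positivity
    _ = 1 := by rw [← Finset.sum_mul_sum, hy, one_mul]

theorem exp_two_le_seventy_five : Real.exp 2 ≤ 75 := by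
  have h := Real.exp_one_lt_d9
  have h0 := Real.exp_pos 1
  rw [show (2 : ℝ) = 1 + 1 by norm_num, Real.exp_add]
  nlinarith

/-- On the event where the row sums and the discrepancies are bounded, the quadratic form of the
deviation at a unit vector is controlled by its light part. -/
theorem abs_quadratic_form_le {n : ℕ} (hn : 0 < n) {r b c : ℝ} (hr : 0 < r) (hb : 0 < b)
    (hc : 24 ≤ c) {S P : Fin n → Fin n → ℝ} (hS0 : ∀ i j, 0 ≤ S i j) (hSs : ∀ i j, S j i = S i j)
    (hP0 : ∀ i j, 0 ≤ P i j) (hP : ∀ i j, P i j ≤ b * (r ^ 2 / n))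
    (deg : ∀ i, ∑ j, S i j ≤ (1 + c) * (b * r ^ 2))
    (disc : ∀ I ∈ smallSets n, ∀ J ∈ smallSets n, I.card ≤ J.card →
      ∑ i ∈ I, ∑ j ∈ J, S i j / b < Real.exp 2 * (I.card * J.card * (r ^ 2 / n)) ∨
      (∑ i ∈ I, ∑ j ∈ J, S i j / b) *
        Real.log ((∑ i ∈ I, ∑ j ∈ J, S i j / b) / (I.card * J.card * (r ^ 2 / n))) <
          c * (J.card * Real.log (n / J.card)))
    {y : Fin n → ℝ} (hy : ∑ i, y i ^ 2 = 1)
    (light : |∑ i, ∑ j, lightPart r y i j * (S i j - P i j)| ≤ c * (b * r)) :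
    |∑ i, ∑ j, y i * y j * (S i j - P i j)| ≤ 721 * (1 + c) * (b * r) := by
  have hn' : (0 : ℝ) < n := Nat.cast_pos.2 hn
  have he3 : Real.exp 1 < 3 := Real.exp_one_lt_three
  let H : Fin n → Fin n → ℝ := fun i j =>
    if r < n * (|y i| * |y j|) then |y i| * |y j| else 0
  have hsplit : ∀ i j, |y i * y j - lightPart r y i j| ≤ H i j := fun i j => by
    simp only [lightPart, H]
    split_ifs with h1 h2 h2
    · exact absurd h2 h1.not_gt
    · simp
    · simp [abs_mul]
    · exact absurd (not_le.1 h1) h2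
  -- As `c ≥ 24`, the constant `3 * (1 + c)` is at least 75, hence exceeds `exp 2`; its factor 3
  -- exceeds `exp 1`, as needed for large `J`.
  have heavyS : ∑ i, ∑ j, H i j * S i j ≤ 240 * (3 * (1 + c)) * r * b := by
    have h := heavy_sum_le (B := fun i j => S i j / b) (K := 3 * (1 + c)) hn hr (by linarith)
      (fun i j => div_nonneg (hS0 i j) hb.le) (fun i j => by rw [hSs]) (fun i => ?_)
      (fun I J hI hIJ => ?_) hy.le
    · calc _ = (∑ i, ∑ j, if r < n * (|y i| * |y j|) then S i j / b * (|y i| * |y j|) else 0)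
            * b := by
            rw [Finset.sum_mul]
            refine Finset.sum_congr rfl fun i _ => ?_
            rw [Finset.sum_mul]
            refine Finset.sum_congr rfl fun j _ => ?_
            simp only [H]
            split_ifs
            · field_simp
            · simp
        _ ≤ _ := by gcongr
    · rw [← Finset.sum_div, div_le_iff₀ hb]
      refine (deg i).trans ?_
      have : 0 ≤ (1 + c) * (b * r ^ 2) := by positivity
      linarith
    · have hI' : (0 : ℝ) < I.card := Nat.cast_pos.2 hI.card_pos
      have hIJ' : (I.card : ℝ) ≤ J.card := Nat.cast_le.2 hIJ
      have hJ' : (0 : ℝ) < J.card := hI'.trans_le hIJ'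
      have hm : 0 ≤ (I.card : ℝ) * J.card * r ^ 2 / n := by positivity
      by_cases hJn : Real.exp 1 * J.card ≤ n
      · have hIn : Real.exp 1 * I.card ≤ n := le_trans (by gcongr) hJn
        have h := disc I (mem_smallSets.2 ⟨hI, hIn⟩) J
          (mem_smallSets.2 ⟨Finset.card_pos.1 (hI.card_pos.trans_le hIJ), hJn⟩) hIJ
        rw [← mul_div_assoc] at h
        refine h.imp (fun h => h.le.trans ?_) fun h => h.le.trans ?_
        · have := exp_two_le_seventy_five
          exact mul_le_mul_of_nonneg_right (by linarith) hm
        · have h1 : 0 ≤ Real.log (n / J.card) := by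
            refine Real.log_nonneg ((one_le_div hJ').2 ?_)
            have := Real.add_one_le_exp 1
            nlinarith
          exact mul_le_mul_of_nonneg_right (by linarith) (by positivity)
      -- More than `n / exp 1` columns: the row sums already give the first alternative.
      · left
        push Not at hJn
        calc ∑ i ∈ I, ∑ j ∈ J, S i j / b ≤ ∑ i ∈ I, (1 + c) * r ^ 2 := by
              refine Finset.sum_le_sum fun i _ => ?_
              rw [← Finset.sum_div, div_le_iff₀ hb]
              refine (Finset.sum_le_sum_of_subset_of_nonneg (Finset.subset_univ J)
                fun j _ _ => hS0 i j).trans ((deg i).trans_eq ?_)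
              ring
          _ = (1 + c) * (I.card * r ^ 2 / n) * n := by
              rw [Finset.sum_const, nsmul_eq_mul]
              field_simp
          _ ≤ (1 + c) * (I.card * r ^ 2 / n) * (3 * J.card) := by
              gcongr
              exact hJn.le.trans (by gcongr)
          _ = _ := by ring
  -- On heavy pairs `r` is less than `n|y i||y j|`, which turns the product of coordinates into that
  -- of their squares.
  have heavyP : ∑ i, ∑ j, H i j * P i j ≤ r * b := by
    calc _ ≤ ∑ i, ∑ j, y i ^ 2 * y j ^ 2 * (r * b) := by
          refine Finset.sum_le_sum fun i _ => Finset.sum_le_sum fun j _ => ?_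
          simp only [H]
          split_ifs with h
          · calc |y i| * |y j| * P i j ≤ |y i| * |y j| * (b * (r ^ 2 / n)) := by
                  gcongr
                  exact hP i j
              _ = |y i| * |y j| * b * r / n * r := by ring
              _ ≤ |y i| * |y j| * b * r / n * (n * (|y i| * |y j|)) := by gcongr
              _ = |y i| ^ 2 * |y j| ^ 2 * (r * b) := by field_simp
              _ = _ := by rw [sq_abs, sq_abs]
          · rw [zero_mul]
            positivity
      _ = _ := by
          simp_rw [← Finset.sum_mul]
          rw [← Finset.sum_mul_sum, hy, one_mul, one_mul]
  have hrest : |∑ i, ∑ j, (y i * y j - lightPart r y i j) * (S i j - P i j)| ≤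
      ∑ i, ∑ j, H i j * S i j + ∑ i, ∑ j, H i j * P i j := by
    simp_rw [← Finset.sum_add_distrib]
    refine (Finset.abs_sum_le_sum_abs _ _).trans (Finset.sum_le_sum fun i _ => ?_)
    refine (Finset.abs_sum_le_sum_abs _ _).trans (Finset.sum_le_sum fun j _ => ?_)
    rw [abs_mul, ← mul_add]
    refine mul_le_mul (hsplit i j) ?_ (abs_nonneg _) ((abs_nonneg _).trans (hsplit i j))
    refine (abs_sub _ _).trans ?_
    rw [abs_of_nonneg (hS0 i j), abs_of_nonneg (hP0 i j)]
  have htot : ∑ i, ∑ j, y i * y j * (S i j - P i j) =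
      ∑ i, ∑ j, lightPart r y i j * (S i j - P i j) +
        ∑ i, ∑ j, (y i * y j - lightPart r y i j) * (S i j - P i j) := by
    simp_rw [← Finset.sum_add_distrib]
    refine Finset.sum_congr rfl fun i _ => Finset.sum_congr rfl fun j _ => ?_
    ring
  rw [htot]
  refine (abs_add_le _ _).trans ?_
  linarith

/-! ### Probabilities of the exceptional events -/

section Model

variable {Ω : Type*} [MeasurableSpace Ω] {μ : Measure Ω} {t n : ℕ}
  {A : Fin (t + 1) → Ω → Matrix (Fin n) (Fin n) ℝ} {p : Fin (t + 1) → Fin n → Fin n → unitInterval}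
  {α : ℝ} {β : Fin (t + 1) → ℝ} {βmax Cβ Cβ' ε r c : ℝ} [IsProbabilityMeasure μ]

/-- Bernstein with coefficients at most `2r/n` and squared sum at most 2 after folding onto the
upper triangle; the powers of `r` and `βmax` cancel, leaving an exponent linear in `n`. The factor 2
is for the two signs. -/
theorem IsSymmBernoulliFamily.light_tail (h : IsSymmBernoulliFamily μ A p) (hn : 0 < n)
    (hr : 0 < r) (hα : α = βmax * (r ^ 2 / n))
    (hp : ∀ k i j, i ≠ j → (p k i j : ℝ) ≤ α) (hβ : SmoothingWeights β βmax Cβ Cβ' ε)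
    (hc : 0 < c) {y : Fin n → ℝ} (hy : ∑ i, y i ^ 2 = 1) :
    μ.real {ω | c * (βmax * r) ≤ |∑ i, ∑ j, lightPart r y i j *
      (smoothedMatrix β A ω i j - matrixExpectation μ (smoothedMatrix β A) i j)|} ≤
      2 * Real.exp (-((c ^ 2 / 2) / (2 * Cβ + 2 / 3 * c)) * n) := by
  have hb := hβ.βmax_pos
  have hC := hβ.Cβ_pos
  have hn' : (0 : ℝ) < n := Nat.cast_pos.2 hn
  have hα0 : 0 < α := by rw [hα]; positivity
  have hexp : -((c * (βmax * r)) ^ 2 / 2) /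
      (Cβ * βmax * α * 2 + βmax * (2 * (r / n)) * (c * (βmax * r)) / 3) =
      -((c ^ 2 / 2) / (2 * Cβ + 2 / 3 * c)) * n := by
    rw [hα]
    field_simp
  have key : ∀ σ : ℝ, |σ| = 1 → μ.real {ω | c * (βmax * r) ≤ σ * ∑ i, ∑ j, lightPart r y i j *
      (smoothedMatrix β A ω i j - matrixExpectation μ (smoothedMatrix β A) i j)} ≤
      Real.exp (-((c ^ 2 / 2) / (2 * Cβ + 2 / 3 * c)) * n) := fun σ hσ => by
    have hσ2 : σ ^ 2 = 1 := by rw [← sq_abs, hσ, one_pow]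
    have h1 := h.bernstein (W := fun i j => σ * lightPart r y i j) (M := 2 * (r / n)) (v := 2)
      (s := c * (βmax * r)) hα0 hp hβ (by positivity) (fun i j _ => ?_) two_pos ?_ (by positivity)
    · rw [hexp] at h1
      refine le_trans (le_of_eq ?_) h1
      congr 1
      ext ω
      simp only [Set.mem_ofPred_eq, mul_sub, Finset.sum_sub_distrib, mul_assoc, ← Finset.mul_sum]
      rw [le_sub_iff_add_le]
    · rw [← mul_add, abs_mul, hσ, one_mul]
      refine (abs_add_le _ _).trans ?_
      linarith [abs_lightPart_le hn hr.le y i j, abs_lightPart_le hn hr.le y j i]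
    · refine (sum_subtype_lt_sq_le fun i j => σ * lightPart r y i j).trans ?_
      simp_rw [mul_pow, hσ2, one_mul]
      linarith [sum_lightPart_sq_le r hy]
  have h1 := key 1 (by simp)
  have h2 := key (-1) (by simp)
  refine le_trans (measureReal_mono ?_) ((measureReal_union_le _ _).trans
    ((add_le_add h1 h2).trans_eq (two_mul _).symm))
  intro ω hω
  rcases le_abs.1 (Set.mem_ofPred_eq ▸ hω) with h3 | h3
  · left
    simpa using h3
  · right
    simpa using h3

/-- A row uses each entry above the diagonal at most once, so Bernstein applies with maximal
coefficient 1 and squared sum at most `n`, around a mean of at most `βmax * r²`. -/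
theorem IsSymmBernoulliFamily.degree_tail (h : IsSymmBernoulliFamily μ A p) (hn : 0 < n)
    (hr : 0 < r) (hα : α = βmax * (r ^ 2 / n))
    (hp : ∀ k i j, i ≠ j → (p k i j : ℝ) ≤ α) (hβ : SmoothingWeights β βmax Cβ Cβ' ε)
    (hc : 0 < c) (i₀ : Fin n) :
    μ.real {ω | (1 + c) * (βmax * r ^ 2) ≤ ∑ j, smoothedMatrix β A ω i₀ j} ≤
      Real.exp (-((c ^ 2 / 2) / (Cβ + 2 * c / 3)) * r ^ 2) := by
  have hb := hβ.βmax_pos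
  have hC := hβ.Cβ_pos
  have hn' : (0 : ℝ) < n := Nat.cast_pos.2 hn
  have hα0 : 0 < α := by rw [hα]; positivity
  let W : Fin n → Fin n → ℝ := fun i _ => if i = i₀ then 1 else 0
  have hW : ∀ F : Fin n → Fin n → ℝ, ∑ i, ∑ j, W i j * F i j = ∑ j, F i₀ j := fun F => by
    rw [Finset.sum_eq_single i₀]
    · simp [W]
    · intro i _ hi
      simp [W, hi]
    · simp
  have hW2 : ∀ i j, i < j → (W i j + W j i) ^ 2 = W i j + W j i := fun i j hij => by
    simp only [W]
    split_ifs with h1 h2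
    · exact absurd (h1.trans h2.symm) hij.ne
    all_goals norm_num
  have h1 := h.bernstein (W := W) (M := 1) (v := n) (s := c * (βmax * r ^ 2)) hα0 hp hβ
    zero_le_one (fun i j hij => ?_) hn' ?_ (by positivity)
  · refine le_trans (measureReal_mono ?_) (h1.trans (Real.exp_le_exp.2 ?_))
    · intro ω hω
      have h2 := hW fun i j => smoothedMatrix β A ω i j
      have h3 := hW fun i j => matrixExpectation μ (smoothedMatrix β A) i j
      have h4 : ∑ j, matrixExpectation μ (smoothedMatrix β A) i₀ j ≤ βmax * r ^ 2 := by
        calc _ ≤ ∑ _j : Fin n, α :=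
              Finset.sum_le_sum fun j _ => h.matrixExpectation_le hα0.le hp hβ i₀ j
          _ = _ := by
              rw [Finset.sum_const, nsmul_eq_mul, Finset.card_univ, Fintype.card_fin, hα]
              field_simp
      simp only [Set.mem_ofPred_eq] at hω ⊢
      rw [h2, h3]
      linarith
    · rw [hα, neg_div, neg_mul, neg_le_neg_iff]
      calc (c ^ 2 / 2) / (Cβ + 2 * c / 3) * r ^ 2 ≤ (c ^ 2 / 2) / (Cβ + c / 3) * r ^ 2 := by
            gcongr
            linarith
        _ = _ := by field_simp
  · have h2 := hW2 i j hij
    have h3 : (W i j + W j i) * (W i j + W j i - 1) = 0 := by linarith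
    rcases mul_eq_zero.1 h3 with h4 | h4
    · simp [h4]
    · rw [sub_eq_zero.1 h4, abs_one]
  · calc _ = ∑ q : {q : Fin n × Fin n // q.1 < q.2}, (W q.1.1 q.1.2 + W q.1.2 q.1.1) :=
          Finset.sum_congr rfl fun q _ => hW2 _ _ q.2
      _ ≤ ∑ i, ∑ j, W i j := sum_subtype_lt_add_le fun i j => by
          simp only [W]
          split_ifs <;> norm_num
      _ = n := (Finset.sum_congr rfl fun i _ => Finset.sum_congr rfl fun j _ =>
          (mul_one (W i j)).symm).trans ((hW fun _ _ => 1).trans (by simp))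

theorem IsSymmBernoulliFamily.discrepancy_tail (h : IsSymmBernoulliFamily μ A p) (hn : 0 < n)
    (hr : 0 < r) (hα : α = βmax * (r ^ 2 / n))
    (hp : ∀ k i j, i ≠ j → (p k i j : ℝ) ≤ α) (hβ : SmoothingWeights β βmax Cβ Cβ' ε)
    {I J : Finset (Fin n)} (hI : I.Nonempty) (hJ : J.Nonempty) (y : ℝ) :
    μ.real {ω | Real.exp 2 * (I.card * J.card * (r ^ 2 / n)) ≤
        ∑ i ∈ I, ∑ j ∈ J, smoothedMatrix β A ω i j / βmax ∧
      y ≤ (∑ i ∈ I, ∑ j ∈ J, smoothedMatrix β A ω i j / βmax) *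
        Real.log ((∑ i ∈ I, ∑ j ∈ J, smoothedMatrix β A ω i j / βmax) /
          (I.card * J.card * (r ^ 2 / n)))} ≤ Real.exp (-(y / 4)) := by
  have hb := hβ.βmax_pos
  have hn' : (0 : ℝ) < n := Nat.cast_pos.2 hn
  have hI' : (0 : ℝ) < I.card := Nat.cast_pos.2 hI.card_pos
  have hJ' : (0 : ℝ) < J.card := Nat.cast_pos.2 hJ.card_pos
  have hm : 0 < (I.card : ℝ) * J.card * (r ^ 2 / n) := by positivity
  have hα0 : 0 ≤ α := by rw [hα]; positivity
  have hα' : r ^ 2 / n = α / βmax := by rw [hα]; field_simp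
  refine measureReal_mul_log_ge_le hm (fun l hl => ?_) y
  have := h.chernoff hα0 hp hβ I J hl
  rwa [← hα'] at this

end Model

/-! ### Union of the exceptional events and conclusion -/

theorem matrixSpectralNorm_tail {Ω : Type*} [MeasurableSpace Ω] {μ : Measure Ω}
    [IsProbabilityMeasure μ] {t n : ℕ} {A : Fin (t + 1) → Ω → Matrix (Fin n) (Fin n) ℝ}
    {p : Fin (t + 1) → Fin n → Fin n → unitInterval} {α : ℝ} {β : Fin (t + 1) → ℝ}
    {βmax Cβ Cβ' ε r c : ℝ} (h : IsSymmBernoulliFamily μ A p) (hn : 0 < n)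
    (hr : 0 < r) (hα : α = βmax * (r ^ 2 / n))
    (hp : ∀ k i j, i ≠ j → (p k i j : ℝ) ≤ α) (hβ : SmoothingWeights β βmax Cβ Cβ' ε)
    (hc : 24 ≤ c) :
    μ.real {ω | 2200 * (1 + c) * (βmax * r) ≤ matrixSpectralNorm
        (smoothedMatrix β A ω - matrixExpectation μ (smoothedMatrix β A))} ≤
      Real.exp (-((c ^ 2 / 2) / (2 * Cβ + 2 / 3 * c) - Real.log 14) * n)
      + Real.exp (-((c ^ 2 / 2) / (Cβ + 2 * c / 3)) * r ^ 2 + Real.log n)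
      + (n : ℝ) ^ (-c / 4 + 6) := by
  have hb := hβ.βmax_pos
  have hn' : (0 : ℝ) < n := Nat.cast_pos.2 hn
  have hα0 : 0 ≤ α := by rw [hα]; positivity
  have hc0 : 0 < c := by linarith
  obtain ⟨N, hNcard, hN1, hN⟩ := exists_matrixSpectralNorm_net n
  let light : Set Ω := ⋃ y ∈ N, {ω | c * (βmax * r) ≤ |∑ i, ∑ j, lightPart r y i j *
    (smoothedMatrix β A ω i j - matrixExpectation μ (smoothedMatrix β A) i j)|}
  let degree : Set Ω := ⋃ i ∈ (Finset.univ : Finset (Fin n)),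
    {ω | (1 + c) * (βmax * r ^ 2) ≤ ∑ j, smoothedMatrix β A ω i j}
  let bad : Finset (Fin n) → Finset (Fin n) → Set Ω := fun I J =>
    {ω | Real.exp 2 * (I.card * J.card * (r ^ 2 / n)) ≤
        ∑ i ∈ I, ∑ j ∈ J, smoothedMatrix β A ω i j / βmax ∧
      c * (J.card * Real.log (n / J.card)) ≤
        (∑ i ∈ I, ∑ j ∈ J, smoothedMatrix β A ω i j / βmax) *
        Real.log ((∑ i ∈ I, ∑ j ∈ J, smoothedMatrix β A ω i j / βmax) /
          (I.card * J.card * (r ^ 2 / n)))}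
  let discrepancy : Set Ω :=
    ⋃ I ∈ smallSets n, ⋃ J ∈ (smallSets n).filter fun J => I.card ≤ J.card, bad I J
  let null : Set Ω := {ω | ¬ ∀ i j, 0 ≤ smoothedMatrix β A ω i j}
  have hlight : μ.real light ≤
      Real.exp (-((c ^ 2 / 2) / (2 * Cβ + 2 / 3 * c) - Real.log 14) * n) := by
    refine (measureReal_biUnion_finset_le _ _).trans ?_
    calc _ ≤ ∑ y ∈ N, 2 * Real.exp (-((c ^ 2 / 2) / (2 * Cβ + 2 / 3 * c)) * n) :=
          Finset.sum_le_sum fun y hy => h.light_tail hn hr hα hp hβ hc0 (hN1 y hy)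
      _ ≤ 14 ^ n * Real.exp (-((c ^ 2 / 2) / (2 * Cβ + 2 / 3 * c)) * n) := by
          rw [Finset.sum_const, nsmul_eq_mul, ← mul_assoc]
          gcongr
          -- The 14 is 7 from the net times 2 from the signs.
          calc (N.card : ℝ) * 2 ≤ 7 ^ n * 2 ^ n := by
                gcongr
                · exact_mod_cast hNcard
                · exact le_self_pow₀ one_le_two hn.ne'
            _ = 14 ^ n := by
                rw [← mul_pow]
                norm_num
      _ = _ := by
          rw [neg_sub, sub_mul, Real.exp_sub, mul_comm (Real.log 14), Real.exp_nat_mul,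
            Real.exp_log (by norm_num), neg_mul, Real.exp_neg]
          rfl
  have hdegree : μ.real degree ≤
      Real.exp (-((c ^ 2 / 2) / (Cβ + 2 * c / 3)) * r ^ 2 + Real.log n) := by
    refine (measureReal_biUnion_finset_le _ _).trans ?_
    refine (Finset.sum_le_sum fun i _ => h.degree_tail hn hr hα hp hβ hc0 i).trans ?_
    rw [Finset.sum_const, nsmul_eq_mul, Finset.card_univ, Fintype.card_fin, Real.exp_add,
      Real.exp_log hn', mul_comm]
  have hdisc : μ.real discrepancy ≤ (n : ℝ) ^ (-c / 4 + 6) := by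
    refine le_trans ?_ (sum_sum_smallSets_exp_le (n := n) (c := c) (by linarith))
    refine (measureReal_biUnion_finset_le _ _).trans (Finset.sum_le_sum fun I hI => ?_)
    refine (measureReal_biUnion_finset_le _ _).trans (Finset.sum_le_sum fun J hJ => ?_)
    exact h.discrepancy_tail hn hr hα hp hβ (mem_smallSets.1 hI).1
      (mem_smallSets.1 (Finset.mem_filter.1 hJ).1).1 _
  have hnull : μ.real null = 0 := by
    rw [measureReal_def, ae_iff.1 (h.ae_smoothedMatrix_nonneg hβ), ENNReal.toReal_zero]
  have hsub : {ω | 2200 * (1 + c) * (βmax * r) ≤ matrixSpectralNorm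
      (smoothedMatrix β A ω - matrixExpectation μ (smoothedMatrix β A))} ⊆
      ((light ∪ degree) ∪ discrepancy) ∪ null := by
    intro ω hω
    by_contra hgood
    simp only [Set.mem_union, not_or] at hgood
    obtain ⟨⟨⟨h1, h2⟩, h3⟩, h4⟩ := hgood
    have h4' : ∀ i j, 0 ≤ smoothedMatrix β A ω i j := not_not.1 h4
    have h2' : ∀ i, ∑ j, smoothedMatrix β A ω i j ≤ (1 + c) * (βmax * r ^ 2) := fun i => by
      by_contra hlt
      exact h2 (Set.mem_biUnion (Finset.mem_univ i) (not_le.1 hlt).le)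
    -- Positivity makes `3 * 721 = 2163 < 2200` a strict contradiction.
    have hpos : 0 < (1 + c) * (βmax * r) := by positivity
    have hnorm : matrixSpectralNorm
        (smoothedMatrix β A ω - matrixExpectation μ (smoothedMatrix β A)) ≤
        3 * (721 * (1 + c) * (βmax * r)) := by
      refine hN _ (fun i j => ?_) _ (by positivity) fun y hy => ?_
      · rw [Matrix.sub_apply, Matrix.sub_apply, h.smoothedMatrix_symm, h.matrixExpectation_symm]
      · refine abs_quadratic_form_le hn hr hb hc h4' (h.smoothedMatrix_symm β ω)
          (h.matrixExpectation_nonneg hβ)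
          (fun i j => (h.matrixExpectation_le hα0 hp hβ i j).trans_eq hα) h2'
          (fun I hI J hJ hIJ => ?_) (hN1 y hy) ?_
        · by_contra hbad
          rw [not_or, not_lt, not_lt] at hbad
          exact h3 (Set.mem_biUnion hI
            (Set.mem_biUnion (Finset.mem_filter.2 ⟨hJ, hIJ⟩) hbad))
        · by_contra hlt
          exact h1 (Set.mem_biUnion hy (not_le.1 hlt).le)
    have hω' : 2200 * (1 + c) * (βmax * r) ≤ matrixSpectralNorm
        (smoothedMatrix β A ω - matrixExpectation μ (smoothedMatrix β A)) := hω
    linarith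
  calc _ ≤ μ.real (((light ∪ degree) ∪ discrepancy) ∪ null) := measureReal_mono hsub
    _ ≤ μ.real light + μ.real degree + μ.real discrepancy + μ.real null :=
        (measureReal_union_le _ _).trans (add_le_add_left ((measureReal_union_le _ _).trans
          (add_le_add_left (measureReal_union_le _ _) _)) _)
    _ ≤ _ := by linarith

theorem theorem3 :
    ∃ C : ℝ, 0 < C ∧
      ∀ {Ω : Type*} [MeasurableSpace Ω] (μ : Measure Ω) [IsProbabilityMeasure μ] (t n : ℕ)
        (A : Fin (t + 1) → Ω → Matrix (Fin n) (Fin n) ℝ)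
        (p : Fin (t + 1) → Fin n → Fin n → unitInterval)
        (α : ℝ) (β : Fin (t + 1) → ℝ) (βmax Cβ Cβ' ε : ℝ),
        IsSymmBernoulliFamily μ A p →
        (∀ k i j, i ≠ j → (p k i j : ℝ) ≤ α) →
        SmoothingWeights β βmax Cβ Cβ' ε →
        ∀ c : ℝ, 0 < c →
          μ.real {ω | C * (1 + c) * Real.sqrt (n * α * βmax) ≤
              matrixSpectralNorm
                (smoothedMatrix β A ω - matrixExpectation μ (smoothedMatrix β A))} ≤
            Real.exp (-((c ^ 2 / 2) / (2 * Cβ + 2 / 3 * c) - Real.log 14) * n)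
            + Real.exp (-((c ^ 2 / 2) / (Cβ + 2 * c / 3)) * (n * α / βmax) + Real.log n)
            + (n : ℝ) ^ (-c / 4 + 6) := by
  refine ⟨2200, by norm_num, ?_⟩
  intro Ω _ μ _ t n A p α β βmax Cβ Cβ' ε h hp hβ c hc
  have hb := hβ.βmax_pos
  have e1 := Real.exp_pos (-((c ^ 2 / 2) / (2 * Cβ + 2 / 3 * c) - Real.log 14) * n)
  have e2 := Real.exp_pos (-((c ^ 2 / 2) / (Cβ + 2 * c / 3)) * (n * α / βmax) + Real.log n)
  have e3 : 0 ≤ (n : ℝ) ^ (-c / 4 + 6) := by positivity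
  have hone : μ.real {ω | 2200 * (1 + c) * Real.sqrt (n * α * βmax) ≤ matrixSpectralNorm
      (smoothedMatrix β A ω - matrixExpectation μ (smoothedMatrix β A))} ≤ 1 :=
    measureReal_le_one
  rcases Nat.eq_zero_or_pos n with rfl | hn
  · refine hone.trans ?_
    simp only [Nat.cast_zero, mul_zero, Real.exp_zero] at e2 e3 ⊢
    linarith
  have hn' : (1 : ℝ) ≤ n := Nat.one_le_cast.2 hn
  -- For `c < 24` the last error term is at least 1 and the bound is trivial.
  rcases lt_or_ge c 24 with hc24 | hc24
  · have : 1 ≤ (n : ℝ) ^ (-c / 4 + 6) := Real.one_le_rpow hn' (by linarith)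
    linarith
  -- The last term is 1 here. Excluding this case provides an off-diagonal entry, which forces `0 ≤
  -- α`.
  rcases eq_or_ne n 1 with rfl | hn1
  · rw [Nat.cast_one, Real.one_rpow] at *
    linarith
  have hα : 0 ≤ α := by
    have h01 : (⟨0, hn⟩ : Fin n) ≠ ⟨1, by lia⟩ := by simp
    exact (p 0 _ _).2.1.trans (hp 0 _ _ h01)
  -- If `α = 0` then `r` would vanish, but the second error term is at least 1.
  rcases hα.eq_or_lt with rfl | hα
  · have : 1 ≤ Real.exp (-((c ^ 2 / 2) / (Cβ + 2 * c / 3)) * (n * 0 / βmax) + Real.log n) := by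
      rw [mul_zero, zero_div, mul_zero, zero_add]
      exact Real.one_le_exp (Real.log_nonneg hn')
    linarith
  have hr0 : 0 < n * α / βmax := by positivity
  have hr2 : Real.sqrt (n * α / βmax) ^ 2 = n * α / βmax := Real.sq_sqrt hr0.le
  have hbr : Real.sqrt (n * α * βmax) = βmax * Real.sqrt (n * α / βmax) := by
    rw [show n * α * βmax = βmax ^ 2 * (n * α / βmax) by field_simp,
      Real.sqrt_mul (sq_nonneg _), Real.sqrt_sq hb.le]
  have key := matrixSpectralNorm_tail h hn (Real.sqrt_pos.2 hr0)
    (by rw [hr2]; field_simp) hp hβ hc24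
  rwa [hr2, ← hbr] at key
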